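/- Let $n\ge 2$ and let $p\ge 1$ be an integer coprime to $n$. Let $\Phi=\{e_i-e_j: i\neq j\}$ be the root system of type $A_{n-1}$ in $V=\{x\in\mathbb R^n:\sum_i x_i=0\}$ with simple roots $\alpha_i=e_i-e_{i+1}$, highest root $\theta=e_1-e_n$, Coxeter number $h=n$, coroot lattice $\check Q=V\cap\mathbb Z^n$, fundamental alcove $A_\circ=\{x\in V:\langle x,\alpha_i\rangle>0\ \forall i,\ \langle x,\theta\rangle<1\}$ and affine Weyl group $\widetilde W$ (generated by the reflections $s_\alpha^k$ in the hyperplanes $\langle x,\alpha\rangle=k$, $\alpha\in\Phi$, $k\in\mathbb Z$). *Uniform Anderson map.* Write $p=ah+b$ with integers $a\ge0$, $0<b<h$. The Sommers region $\mathcal S^p$ is the set of $x\in V$ with $\langle x,\alpha\rangle>-a$ for all roots $\alpha$ of height $b$ and $\langle x,\alpha\rangle<a+1$ for all roots $\alpha$ of height $h-b$. Let $\widetilde w_p\in\widetilde W$ be the element with $\widetilde w_p(\mathcal S^p)=pA_\circ$. An element $\widetilde w=wt_\mu\in\widetilde W$ acts on affine roots by $\widetilde w(\alpha+k\delta)=w(\alpha)+(k-\langle\mu,\alpha\rangle)\delta$.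 It is $p$-stable ($\widetilde w\in\widetilde W^p$) if it maps every affine root $\alpha+k\delta$ of height $\mathrm{ht}(\alpha)+kh=p$ to a positive affine root. Define $\mathcal A:\widetilde W^p\to\check Q/p\check Q$, $\widetilde w\mapsto \widetilde w\,\widetilde w_p^{-1}\cdot 0+p\check Q$. *Gorsky–Mazin–Vazirani map.* Let $\widetilde S_n$ be the group of bijections $\sigma$ of $\mathbb Z$ with $\sigma(i+n)=\sigma(i)+n$ and $\sum_{i=1}^n\sigma(i)=\binom{n+1}2$, and let $\widetilde S_n^p$ be the set of those with $\sigma(i+p)>\sigma(i)$ for all $i$. For $\widetilde w\in\widetilde S_n^p$ let $\Delta=\{l\in\mathbb Z:\widetilde w(l)>0\}$ and $M=\min\Delta$. Label the box $(x,y)\in\mathbb Z^2$ by $l(x,y)=-n-nx+py$, and let $D$ be the set of boxes with $0\le x<p$, $0\le y<n$ and $l(x,y)\in\Delta-M$. For $i=1,\dots,n$ let $P_i$ be the number of boxes of $D$ with $y=i-1$, and let $\sigma(i)=\widetilde w(l(P_i-1,i-1)+M)$. Then $(P,\sigma)$ is a vertically labelled $p/n$-Dyck path: $0\le P_1\le\dots\le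 P_n$, $P_i\le\frac pn(i-1)$, $\sigma\in S_n$, and $\sigma(i)<\sigma(i+1)$ whenever $P_i=P_{i+1}$. It is identified with the tuple $f$ given by $f_{\sigma(i)}=P_i$, which lies in the set $\mathcal{PF}_{p/n}$ of $p/n$-parking functions, i.e. of tuples $f\in\mathbb Z_{\ge0}^n$ with $\#\{i:f_i<l\}\ge nl/p$ for $l=1,\dots,p$. Put $\mathcal A_{GMV}(\widetilde w)=(P,\sigma)=f$. Let $\pi_{\check Q}:\check Q/p\check Q\to\mathbb Z_p^n/(1,\dots,1)$ and $\pi_{\mathcal{PF}}:\mathcal{PF}_{p/n}\to\mathbb Z_p^n/(1,\dots,1)$ be reduction modulo $p$ followed by the projection to the quotient of $\mathbb Z_p^n$ by the cyclic subgroup generated by $(1,\dots,1)$. **Theorem.** The element $\widetilde w_p$ exists and is unique, and $\pi_{\check Q}$ and $\pi_{\mathcal{PF}}$ are bijections. There is a group isomorphism $\widetilde W\cong\widetilde S_n$ that sends $s_\theta^1$ and $s_{\alpha_j}^0$ ($1\le j\le n-1$) to the affine simple transpositions $\widetilde s_0$ and $\widetilde s_j$, where $\widetilde s_j(i)=i+1$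 for $i\equiv j$, $\widetilde s_j(i)=i-1$ for $i\equiv j+1$ modulo $n$, and $\widetilde s_j(i)=i$ otherwise. It maps $\widetilde W^p$ onto $\widetilde S_n^p$, and with this identification $$\pi_{\check Q}\circ\mathcal A=\pi_{\mathcal{PF}}\circ\mathcal A_{GMV}.$$ -/

import Mathlib

noncomputable section

namespace Anderson

/-! ## Irreducible crystallographic root systems and their affine Weyl groups -/

/-- An irreducible reduced crystallographic root system in a Euclidean space `V`, together with a
choice of simple roots (indexed by `ι`). -/
structure BasedRootSystem (ι V : Type*) [Fintype ι] [NormedAddCommGroup V]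
    [InnerProductSpace ℝ V] where
  /-- The set of roots. -/
  roots : Set V
  finite : roots.Finite
  nonempty : roots.Nonempty
  zero_notMem : (0 : V) ∉ roots
  reflection_mem : ∀ α ∈ roots, ∀ β ∈ roots,
    β - (2 * inner ℝ β α / inner ℝ α α) • α ∈ roots
  integral : ∀ α ∈ roots, ∀ β ∈ roots, ∃ z : ℤ, 2 * inner ℝ β α / inner ℝ α α = (z : ℝ)
  reduced : ∀ α ∈ roots, ∀ c : ℝ, c • α ∈ roots → c = 1 ∨ c = -1
  irreducible : ∀ S ⊆ roots, S.Nonempty → (roots \ S).Nonempty →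
    ∃ α ∈ S, ∃ β ∈ roots \ S, inner ℝ α β ≠ 0
  /-- The simple roots; they form a basis of the ambient space. -/
  simple : Module.Basis ι ℝ V
  simple_mem : ∀ i, simple i ∈ roots
  pos_or_neg : ∀ α ∈ roots, (∃ c : ι → ℕ, α = ∑ i, (c i : ℝ) • simple i) ∨
    (∃ c : ι → ℕ, α = -∑ i, (c i : ℝ) • simple i)

section AffineReflection

variable {V : Type*} [NormedAddCommGroup V] [InnerProductSpace ℝ V]

/-- The coroot `2 α / ⟨α, α⟩`. -/
def coroot (α : V) : V := (2 / inner ℝ α α) • α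

theorem reflection_invol (α : V) (k : ℝ) (x : V) :
    (x - (2 * ((inner ℝ x α - k) / inner ℝ α α)) • α) -
      (2 * ((inner ℝ (x - (2 * ((inner ℝ x α - k) / inner ℝ α α)) • α) α - k) /
        inner ℝ α α)) • α = x := by
  by_cases h : α = 0
  · simp [h]
  · have h' : (inner ℝ α α : ℝ) ≠ 0 := inner_self_ne_zero.mpr h
    rw [inner_sub_left, real_inner_smul_left, sub_sub, ← add_smul]
    have : 2 * ((inner ℝ x α - k) / inner ℝ α α) + 2 * ((inner ℝ x α -
        2 * ((inner ℝ x α - k) / inner ℝ α α) * inner ℝ α α - k) / inner ℝ α α) = (0 : ℝ) := by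
      field_simp
      ring
    rw [this, zero_smul, sub_zero]

/-- The affine reflection `x ↦ x - 2 (⟨x, α⟩ - k) / ⟨α, α⟩ • α` through the hyperplane
`⟨x, α⟩ = k`. -/
def affReflection (α : V) (k : ℤ) : V ≃ᵃ[ℝ] V where
  toFun x := x - (2 * ((inner ℝ x α - (k : ℝ)) / inner ℝ α α)) • α
  invFun x := x - (2 * ((inner ℝ x α - (k : ℝ)) / inner ℝ α α)) • α
  left_inv := reflection_invol α k
  right_inv := reflection_invol α k
  linear :=
    { toFun := fun x => x - (2 * (inner ℝ x α / inner ℝ α α)) • α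
      invFun := fun x => x - (2 * (inner ℝ x α / inner ℝ α α)) • α
      left_inv := fun x => by simpa using reflection_invol α 0 x
      right_inv := fun x => by simpa using reflection_invol α 0 x
      map_add' := fun x y => by
        simp only [inner_add_left, add_div, mul_add, add_smul]
        abel
      map_smul' := fun c x => by
        simp only [real_inner_smul_left, RingHom.id_apply, smul_sub, smul_smul]
        congr 2
        ring }
  map_vadd' x v := by
    simp only [vadd_eq_add, Equiv.coe_fn_mk, LinearEquiv.coe_mk, LinearMap.coe_mk, AddHom.coe_mk,
      inner_add_left]
    have : 2 * ((inner ℝ v α + inner ℝ x α - (k : ℝ)) / inner ℝ α α) =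
      2 * (inner ℝ v α / inner ℝ α α) + 2 * ((inner ℝ x α - (k : ℝ)) / inner ℝ α α) := by ring
    rw [this, add_smul]
    abel

theorem affReflection_apply (α : V) (k : ℤ) (x : V) :
    affReflection α k x = x - (2 * ((inner ℝ x α - (k : ℝ)) / inner ℝ α α)) • α := rfl

end AffineReflection

namespace BasedRootSystem

variable {ι V : Type*} [Fintype ι] [NormedAddCommGroup V] [InnerProductSpace ℝ V]
variable (Φ : BasedRootSystem ι V)

/-- The height: the sum of the coefficients with respect to the simple roots. -/
def height (α : V) : ℝ := ∑ i, Φ.simple.repr α i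

/-- The positive roots: those with nonnegative coefficients in the simple roots. -/
def positiveRoots : Set V := {α ∈ Φ.roots | ∀ i, 0 ≤ Φ.simple.repr α i}

theorem exists_highest : ∃ θ ∈ Φ.roots, ∀ α ∈ Φ.roots, Φ.height α ≤ Φ.height θ :=
  Set.exists_max_image Φ.roots Φ.height Φ.finite Φ.nonempty

/-- The highest root: the (unique) root of maximal height. -/
def highestRoot : V := Φ.exists_highest.choose

theorem highestRoot_mem : Φ.highestRoot ∈ Φ.roots := Φ.exists_highest.choose_spec.1

/-- The Coxeter number `h = 1 + ht(θ)`; heights of roots are integers, so the floor only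
changes the type. -/
def coxeterNumber : ℕ := 1 + ⌊Φ.height Φ.highestRoot⌋₊

/-- The coroot lattice: the additive group generated by the coroots. -/
def corootLattice : AddSubgroup V := AddSubgroup.closure (coroot '' Φ.roots)

/-- The affine Weyl group, generated by all reflections in the hyperplanes `⟨x, α⟩ = k`. -/
def affineWeylGroup : Subgroup (V ≃ᵃ[ℝ] V) :=
  Subgroup.closure {s | ∃ α ∈ Φ.roots, ∃ k : ℤ, s = affReflection α k}

/-- The reflection in the hyperplane `⟨x, α⟩ = k`, as an element of the affine Weyl group. -/
def reflection {α : V} (hα : α ∈ Φ.roots) (k : ℤ) : Φ.affineWeylGroup :=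
  ⟨affReflection α k, Subgroup.subset_closure ⟨α, hα, k, rfl⟩⟩

/-- The (open) fundamental alcove. -/
def fundamentalAlcove : Set V :=
  {x | (∀ i, 0 < inner ℝ x (Φ.simple i)) ∧ inner ℝ x Φ.highestRoot < 1}

/-! Affine roots: `α + k δ` is the pair `(α, k)` in `V × ℝ = V ⊕ ℝ δ`. -/

/-- The affine roots `α + k δ` with `α` a root and `k` an integer. -/
def affineRoots : Set (V × ℝ) := {a | a.1 ∈ Φ.roots ∧ ∃ k : ℤ, a.2 = k}

/-- The positive affine roots. -/
def positiveAffineRoots : Set (V × ℝ) :=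
  {a ∈ Φ.affineRoots | (a.1 ∈ Φ.positiveRoots ∧ 0 ≤ a.2) ∨ (-a.1 ∈ Φ.positiveRoots ∧ 0 < a.2)}

/-- The height `ht(α + k δ) = ht(α) + k h`. -/
def affineHeight (a : V × ℝ) : ℝ := Φ.height a.1 + a.2 * Φ.coxeterNumber

/-- The action `(w t_μ)(α + k δ) = w(α) + (k - ⟨μ, α⟩) δ`. For `g = w t_μ` the linear part is `w`
and `μ = w⁻¹(g 0)`. -/
def affineRootAction (g : V ≃ᵃ[ℝ] V) (a : V × ℝ) : V × ℝ :=
  (g.linear a.1, a.2 - inner ℝ (g.linear.symm (g 0)) a.1)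

/-- The `p`-stable elements of the affine Weyl group: every affine root of height `p` is mapped to
a positive affine root. -/
def stable (p : ℕ) : Set Φ.affineWeylGroup :=
  {g | ∀ a ∈ Φ.affineRoots, Φ.affineHeight a = p →
    affineRootAction (g : V ≃ᵃ[ℝ] V) a ∈ Φ.positiveAffineRoots}

/-- The Sommers region. With `p = a h + b`, `0 ≤ b < h`, it is cut out by `⟨x, α⟩ > -a` for roots
of height `b` and `⟨x, α⟩ < a + 1` for roots of height `h - b`. -/
def sommersRegion (p : ℕ) : Set V :=
  {x | (∀ α ∈ Φ.roots, Φ.height α = ((p % Φ.coxeterNumber : ℕ) : ℝ) →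
        -((p / Φ.coxeterNumber : ℕ) : ℝ) < inner ℝ x α) ∧
      (∀ α ∈ Φ.roots,
        Φ.height α = (Φ.coxeterNumber : ℝ) - ((p % Φ.coxeterNumber : ℕ) : ℝ) →
        inner ℝ x α < ((p / Φ.coxeterNumber : ℕ) : ℝ) + 1)}

/-- The dilated fundamental alcove `p A`. -/
def dilatedAlcove (p : ℕ) : Set V := (fun x : V => (p : ℝ) • x) '' Φ.fundamentalAlcove

/-- `g` maps the Sommers region onto the dilated fundamental alcove. -/
def IsSommersElement (p : ℕ) (g : Φ.affineWeylGroup) : Prop :=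
  (g : V ≃ᵃ[ℝ] V) '' Φ.sommersRegion p = Φ.dilatedAlcove p

open Classical in
/-- The unique element of the affine Weyl group mapping the Sommers region onto the dilated
fundamental alcove. (It exists and is unique if `p` is coprime to the Coxeter number; otherwise the
value is irrelevant.) -/
def sommersElement (p : ℕ) : Φ.affineWeylGroup :=
  if h : ∃! g, Φ.IsSommersElement p g then h.choose else 1

theorem inner_int_of_mem_corootLattice {α : V} (hα : α ∈ Φ.roots) {x : V}
    (hx : x ∈ Φ.corootLattice) : ∃ z : ℤ, inner ℝ x α = (z : ℝ) := by
  induction hx using AddSubgroup.closure_induction with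
  | mem x hx =>
    obtain ⟨β, hβ, rfl⟩ := hx
    obtain ⟨z, hz⟩ := Φ.integral β hβ α hα
    refine ⟨z, ?_⟩
    rw [← hz, coroot, real_inner_smul_left, real_inner_comm α β]
    ring
  | zero => exact ⟨0, by simp⟩
  | add x y _ _ hx hy =>
    obtain ⟨a, ha⟩ := hx
    obtain ⟨b, hb⟩ := hy
    exact ⟨a + b, by rw [inner_add_left, ha, hb]; push_cast; ring⟩
  | neg x _ hx =>
    obtain ⟨a, ha⟩ := hx
    exact ⟨-a, by rw [inner_neg_left, ha]; push_cast; ring⟩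

theorem affReflection_mem {α : V} (hα : α ∈ Φ.roots) (k : ℤ) {x : V}
    (hx : x ∈ Φ.corootLattice) : affReflection α k x ∈ Φ.corootLattice := by
  obtain ⟨z, hz⟩ := Φ.inner_int_of_mem_corootLattice hα hx
  rw [affReflection_apply]
  refine Φ.corootLattice.sub_mem hx ?_
  have h1 : coroot α ∈ Φ.corootLattice := AddSubgroup.subset_closure ⟨α, hα, rfl⟩
  have h2 := Φ.corootLattice.zsmul_mem h1 (z - k)
  convert h2 using 1
  rw [coroot, hz, ← Int.cast_smul_eq_zsmul ℝ, smul_smul]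
  congr 1
  push_cast
  ring

theorem affineWeylGroup_apply_mem_iff {g : V ≃ᵃ[ℝ] V} (hg : g ∈ Φ.affineWeylGroup) (x : V) :
    g x ∈ Φ.corootLattice ↔ x ∈ Φ.corootLattice := by
  induction hg using Subgroup.closure_induction generalizing x with
  | mem g hg =>
    obtain ⟨α, hα, k, rfl⟩ := hg
    refine ⟨fun h => ?_, Φ.affReflection_mem hα k⟩
    have := Φ.affReflection_mem hα k h
    rwa [show affReflection α k (affReflection α k x) = x from reflection_invol α k x] at this
  | one => exact Iff.rfl
  | mul g g' _ _ h h' => exact (h (g' x)).trans (h' x)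
  | inv g _ h =>
    have := h (g⁻¹ x)
    rw [show g (g⁻¹ x) = x from g.apply_symm_apply x] at this
    exact this.symm

/-- The element `g • 0` of the coroot lattice. -/
def orbitZero (g : Φ.affineWeylGroup) : Φ.corootLattice :=
  ⟨(g : V ≃ᵃ[ℝ] V) 0, (Φ.affineWeylGroup_apply_mem_iff g.2 0).2 Φ.corootLattice.zero_mem⟩

/-- The sublattice `p Q` of the coroot lattice `Q`. -/
def dilatedCorootLattice (p : ℕ) : AddSubgroup Φ.corootLattice :=
  (nsmulAddMonoidHom p : Φ.corootLattice →+ Φ.corootLattice).range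

/-- The finite torus `Q / p Q`. -/
abbrev FiniteTorus (p : ℕ) : Type _ := Φ.corootLattice ⧸ Φ.dilatedCorootLattice p

/-- The uniform Anderson map `g ↦ g g_p⁻¹ • 0 + p Q`, where `g_p` is the element mapping the
Sommers region onto the dilated fundamental alcove. -/
def uniformAnderson (p : ℕ) (g : Φ.stable p) : Φ.FiniteTorus p :=
  QuotientAddGroup.mk (Φ.orbitZero (g.1 * (Φ.sommersElement p)⁻¹))

end BasedRootSystem

/-! ## The root system of type `A_{n-1}`

Coordinates are indexed by `Fin n`; the index `i : Fin n` is the coordinate number `i + 1`. -/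

/-- The ambient space: vectors in `ℝ^n` with coordinate sum zero. -/
def hyper (n : ℕ) : Submodule ℝ (EuclideanSpace ℝ (Fin n)) where
  carrier := {x | ∑ i, x i = 0}
  add_mem' {x y} hx hy := by
    simp only [Set.mem_ofPred_eq] at hx hy ⊢
    simp [Finset.sum_add_distrib, hx, hy]
  zero_mem' := by simp
  smul_mem' c x hx := by
    simp only [Set.mem_ofPred_eq] at hx ⊢
    simp [← Finset.mul_sum, hx]

/-- The vector `e_i - e_j`. -/
def eDiff {n : ℕ} (i j : Fin n) : hyper n :=
  ⟨EuclideanSpace.single i 1 - EuclideanSpace.single j 1, by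
    simp [hyper, Finset.sum_sub_distrib]⟩

theorem inner_eDiff {n : ℕ} (x : hyper n) (i j : Fin n) :
    (inner ℝ x (eDiff i j) : ℝ) = x.1 i - x.1 j := by
  rw [Submodule.coe_inner]
  simp [eDiff, inner_sub_right, EuclideanSpace.inner_single_right]

theorem eDiff_apply {n : ℕ} (i j k : Fin n) :
    (eDiff i j).1 k = (if k = i then 1 else 0) - (if k = j then 1 else 0) := by
  simp [eDiff]

theorem eDiff_add {n : ℕ} (i j k : Fin n) : eDiff i j + eDiff j k = eDiff i k := by
  apply Subtype.ext
  simp [eDiff]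

theorem eDiff_self {n : ℕ} (i : Fin n) : eDiff i i = 0 := by
  apply Subtype.ext
  simp [eDiff]

theorem eDiff_neg {n : ℕ} (i j : Fin n) : -eDiff i j = eDiff j i := by
  apply Subtype.ext
  simp [eDiff]

theorem eDiff_inner_self {n : ℕ} {i j : Fin n} (h : i ≠ j) :
    (inner ℝ (eDiff i j) (eDiff i j) : ℝ) = 2 := by
  rw [inner_eDiff, eDiff_apply, eDiff_apply]
  simp [h, h.symm]
  norm_num

/-- The simple root `e_i - e_{i+1}`. -/
def simpleVec (n : ℕ) (i : Fin (n - 1)) : hyper n :=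
  eDiff ⟨i, by omega⟩ ⟨i + 1, by omega⟩

theorem eDiff_eq_sum {n : ℕ} (i d : ℕ) (h : i + d < n) :
    ∃ c : Fin (n - 1) → ℕ,
      eDiff (⟨i, by omega⟩ : Fin n) ⟨i + d, h⟩ = ∑ k, (c k : ℝ) • simpleVec n k := by
  induction d with
  | zero => exact ⟨0, by simpa using eDiff_self _⟩
  | succ d ih =>
    obtain ⟨c, hc⟩ := ih (by omega)
    refine ⟨c + Pi.single ⟨i + d, by omega⟩ 1, ?_⟩
    rw [← eDiff_add _ (⟨i + d, by omega⟩ : Fin n), hc]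
    simp only [Pi.add_apply, Nat.cast_add, add_smul, Finset.sum_add_distrib]
    congr 1
    rw [Finset.sum_eq_single (⟨i + d, by omega⟩ : Fin (n - 1))]
    · simp [simpleVec, add_assoc]
    · intro b _ hb
      simp [hb]
    · simp

theorem eDiff_pos_or_neg {n : ℕ} (i j : Fin n) :
    (∃ c : Fin (n - 1) → ℕ, eDiff i j = ∑ k, (c k : ℝ) • simpleVec n k) ∨
    (∃ c : Fin (n - 1) → ℕ, eDiff i j = -∑ k, (c k : ℝ) • simpleVec n k) := by
  rcases le_total i j with h | h
  · obtain ⟨d, hd⟩ := Nat.exists_eq_add_of_le (Fin.le_def.mp h)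
    left
    obtain ⟨c, hc⟩ := eDiff_eq_sum (n := n) i d (by omega)
    refine ⟨c, ?_⟩
    rw [← hc]
    congr 1
    exact Fin.ext hd
  · obtain ⟨d, hd⟩ := Nat.exists_eq_add_of_le (Fin.le_def.mp h)
    right
    obtain ⟨c, hc⟩ := eDiff_eq_sum (n := n) j d (by omega)
    refine ⟨c, ?_⟩
    rw [← hc, eDiff_neg]
    congr 1
    exact Fin.ext hd

theorem simpleVec_linearIndependent (n : ℕ) : LinearIndependent ℝ (simpleVec n) := by
  rw [Fintype.linearIndependent_iff]
  intro g hg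
  have key : ∀ m : ℕ, ∀ hm : m < n - 1, g ⟨m, hm⟩ = 0 := by
    intro m
    induction m using Nat.strong_induction_on with
    | _ m ih =>
      intro hm
      have h := congrArg (fun x : hyper n => x.1 (⟨m, by omega⟩ : Fin n)) hg
      simp only [Submodule.coe_sum, Submodule.coe_smul, WithLp.ofLp_sum, Finset.sum_apply,
        WithLp.ofLp_smul, Pi.smul_apply, simpleVec, eDiff_apply, smul_eq_mul] at h
      rw [Finset.sum_eq_single (⟨m, hm⟩ : Fin (n - 1))] at h
      · simpa using h
      · intro b _ hb
        by_cases hbm : m = b + 1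
        · have := ih b (by omega) b.2
          rw [show g b = 0 from this]
          simp
        · have : m ≠ b := fun h => hb (Fin.ext h.symm)
          simp [hbm, this]
      · simp
  exact fun i => key i i.2

theorem simpleVec_span (n : ℕ) : ⊤ ≤ Submodule.span ℝ (Set.range (simpleVec n)) := by
  have hE : ∀ i j : Fin n, eDiff i j ∈ Submodule.span ℝ (Set.range (simpleVec n)) := by
    intro i j
    have hs : ∀ c : Fin (n - 1) → ℕ,
        ∑ k, (c k : ℝ) • simpleVec n k ∈ Submodule.span ℝ (Set.range (simpleVec n)) := fun c =>
      Submodule.sum_mem _ fun k _ => Submodule.smul_mem _ _ (Submodule.subset_span ⟨k, rfl⟩)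
    rcases eDiff_pos_or_neg i j with ⟨c, hc⟩ | ⟨c, hc⟩
    · rw [hc]; exact hs c
    · rw [hc]; exact Submodule.neg_mem _ (hs c)
  intro x _
  rcases Nat.eq_zero_or_pos n with rfl | hn
  · have : x = 0 := by
      apply Subtype.ext
      ext i
      exact i.elim0
    rw [this]
    exact Submodule.zero_mem _
  · have hx : x = ∑ i, x.1 i • eDiff i ⟨0, hn⟩ := by
      apply Subtype.ext
      ext k
      have h0 : ∑ i, x.1 i = 0 := x.2
      simp only [Submodule.coe_sum, Submodule.coe_smul, WithLp.ofLp_sum, Finset.sum_apply,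
        WithLp.ofLp_smul, Pi.smul_apply, eDiff_apply, smul_eq_mul, mul_sub,
        Finset.sum_sub_distrib, ← Finset.sum_mul, h0]
      simp
    rw [hx]
    exact Submodule.sum_mem _ fun i _ => Submodule.smul_mem _ _ (hE _ _)

/-- The root system of type `A_{n-1}`: roots `e_i - e_j` with `i ≠ j`, simple roots
`e_i - e_{i+1}`. -/
def typeA (n : ℕ) (hn : 2 ≤ n) : BasedRootSystem (Fin (n - 1)) (hyper n) where
  roots := {α | ∃ i j : Fin n, i ≠ j ∧ α = eDiff i j}
  finite := by
    refine (Set.finite_range (fun q : Fin n × Fin n => eDiff q.1 q.2)).subset ?_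
    rintro _ ⟨i, j, _, rfl⟩
    exact ⟨(i, j), rfl⟩
  nonempty := ⟨eDiff ⟨0, by omega⟩ ⟨1, by omega⟩, _, _, by simp, rfl⟩
  zero_notMem := by
    rintro ⟨i, j, h, h0⟩
    have := eDiff_inner_self h
    rw [← h0] at this
    simp at this
  reflection_mem := by
    rintro _ ⟨i, j, h, rfl⟩ _ ⟨k, l, h', rfl⟩
    refine ⟨Equiv.swap i j k, Equiv.swap i j l, fun h => h' ((Equiv.swap i j).injective h), ?_⟩
    rw [eDiff_inner_self h, inner_eDiff]
    apply Subtype.ext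
    ext m
    simp only [Submodule.coe_sub, Submodule.coe_smul, WithLp.ofLp_sub, WithLp.ofLp_smul,
      Pi.sub_apply, Pi.smul_apply, eDiff_apply, smul_eq_mul, Equiv.swap_apply_def]
    grind
  integral := by
    rintro _ ⟨i, j, h, rfl⟩ _ ⟨k, l, h', rfl⟩
    rw [eDiff_inner_self h, inner_eDiff, eDiff_apply, eDiff_apply]
    refine ⟨((if i = k then 1 else 0) - (if i = l then 1 else 0)) -
      ((if j = k then 1 else 0) - (if j = l then 1 else 0)), ?_⟩
    push_cast
    ring
  reduced := by
    rintro _ ⟨i, j, h, rfl⟩ c ⟨k, l, h', hc⟩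
    have h1 := eDiff_inner_self h'
    rw [← hc, real_inner_smul_left, real_inner_smul_right, eDiff_inner_self h] at h1
    have : c * c = 1 := by linarith
    exact mul_self_eq_one_iff.mp this
  irreducible := by
    intro S hS hS1 hS2
    by_contra hcon
    push Not at hcon
    obtain ⟨α, hα⟩ := hS1
    obtain ⟨i, j, hij, rfl⟩ := hS hα
    have step : ∀ {a b c d : Fin n}, eDiff a b ∈ S → c ≠ d →
        (inner ℝ (eDiff a b) (eDiff c d) : ℝ) ≠ 0 → eDiff c d ∈ S := by
      intro a b c d hab hcd hne
      by_contra hn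
      exact hne (hcon _ hab _ ⟨⟨c, d, hcd, rfl⟩, hn⟩)
    have s1 : ∀ {a b c : Fin n}, a ≠ b → a ≠ c → eDiff a b ∈ S → eDiff a c ∈ S := by
      intro a b c hab hac hS
      refine step hS hac ?_
      rw [inner_eDiff, eDiff_apply, eDiff_apply]
      by_cases hbc : c = b
      · simp [hbc, hab, hab.symm]
      · simp [hab, hac.symm, hbc]
    have s2 : ∀ {a b c : Fin n}, a ≠ b → eDiff a b ∈ S → eDiff b a ∈ S := by
      intro a b c hab hS
      refine step hS hab.symm ?_
      rw [inner_eDiff, eDiff_apply, eDiff_apply]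
      simp [hab, hab.symm]
      norm_num
    obtain ⟨β, ⟨k, l, hkl, rfl⟩, hβ⟩ := hS2
    apply hβ
    by_cases hik : i = k
    · subst hik
      exact s1 hij hkl hα
    · have h1 : eDiff i k ∈ S := s1 hij hik hα
      have h2 : eDiff k i ∈ S := s2 (c := i) hik h1
      exact s1 (Ne.symm hik) hkl h2
  simple := Module.Basis.mk (simpleVec_linearIndependent n) (simpleVec_span n)
  simple_mem i := by
    rw [Module.Basis.mk_apply]
    exact ⟨_, _, by simp, rfl⟩
  pos_or_neg := by
    rintro _ ⟨i, j, _, rfl⟩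
    simpa only [Module.Basis.mk_apply] using eDiff_pos_or_neg i j

/-! ## Identification of the finite torus with cosets in `(ℤ/p)^n` -/

/-- The quotient of `(ℤ/p)^n` by the cyclic subgroup generated by `(1, …, 1)`. -/
abbrev CyclicQuotient (n p : ℕ) : Type :=
  (Fin n → ZMod p) ⧸ AddSubgroup.zmultiples (fun _ : Fin n => (1 : ZMod p))

theorem coord_int {n : ℕ} {hn : 2 ≤ n} {x : hyper n} (hx : x ∈ (typeA n hn).corootLattice)
    (i : Fin n) : ∃ z : ℤ, x.1 i = (z : ℝ) := by
  induction hx using AddSubgroup.closure_induction with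
  | mem x hx =>
    obtain ⟨_, ⟨k, l, hkl, rfl⟩, rfl⟩ := hx
    refine ⟨(if i = k then 1 else 0) - (if i = l then 1 else 0), ?_⟩
    rw [coroot, eDiff_inner_self hkl, div_self two_ne_zero, one_smul, eDiff_apply]
    push_cast
    rfl
  | zero => exact ⟨0, by simp⟩
  | add x y _ _ hx hy =>
    obtain ⟨a, ha⟩ := hx
    obtain ⟨b, hb⟩ := hy
    exact ⟨a + b, by simp [ha, hb]⟩
  | neg x _ hx =>
    obtain ⟨a, ha⟩ := hx
    exact ⟨-a, by simp [ha]⟩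

/-- Reduction mod `p` of the coroot lattice. Elements of the coroot lattice have integer
coordinates, so the floor only changes the type. -/
def modP (n p : ℕ) (hn : 2 ≤ n) : (typeA n hn).corootLattice →+ (Fin n → ZMod p) where
  toFun x i := ((⌊x.1.1 i⌋ : ℤ) : ZMod p)
  map_zero' := by
    funext i
    simp
  map_add' x y := by
    funext i
    obtain ⟨a, ha⟩ := coord_int x.2 i
    obtain ⟨b, hb⟩ := coord_int y.2 i
    simp only [AddSubgroup.coe_add, Submodule.coe_add, WithLp.ofLp_add, Pi.add_apply, ha, hb]
    rw [← Int.cast_add, Int.floor_intCast, Int.floor_intCast, Int.floor_intCast]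
    push_cast
    rfl

/-- The map `Q / p Q → (ℤ/p)^n / (1, …, 1)` given by reduction mod `p` and projection. -/
def piTorus (n p : ℕ) (hn : 2 ≤ n) : (typeA n hn).FiniteTorus p →+ CyclicQuotient n p :=
  QuotientAddGroup.lift ((typeA n hn).dilatedCorootLattice p)
    ((QuotientAddGroup.mk' _).comp (modP n p hn)) (by
      rintro _ ⟨x, rfl⟩
      have : modP n p hn (p • x) = 0 := by
        rw [map_nsmul]
        funext i
        simp
      simp only [nsmulAddMonoidHom_apply]
      rw [AddMonoidHom.mem_ker, AddMonoidHom.comp_apply, this, map_zero])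

/-! ## Rational parking functions and vertically labelled Dyck paths -/

/-- The rational `p/n`-parking functions: `#{i : f_i < l} ≥ n l / p` for `l = 1, …, p`. -/
def parkingFunctions (n p : ℕ) : Set (Fin n → ℕ) :=
  {f | ∀ l : ℕ, 1 ≤ l → l ≤ p → n * l ≤ p * (Finset.univ.filter fun i => f i < l).card}

/-- The projection from parking functions to `(ℤ/p)^n / (1, …, 1)`. -/
def piParking (n p : ℕ) (f : parkingFunctions n p) : CyclicQuotient n p :=
  QuotientAddGroup.mk (fun i => ((f.1 i : ℕ) : ZMod p))

/-- A vertically labelled `p/n`-Dyck path. The path is given by the `x`-coordinates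
`path i` of its North steps (the index `i : Fin n` is the North step number `i + 1`), and `label i`
is the label of that step (the label `k : Fin n` stands for the number `k + 1`). -/
@[ext]
structure LabelledDyckPath (n p : ℕ) where
  path : Fin n → ℕ
  monotone : Monotone path
  above_diagonal : ∀ i : Fin n, n * path i ≤ p * i
  label : Equiv.Perm (Fin n)
  rise : ∀ i j : Fin n, (j : ℕ) = i + 1 → path i = path j → label i < label j

/-- The parking function `σ · (P_1, …, P_n)` of a vertically labelled Dyck path `(P, σ)`: its value
at the label of a North step is the `x`-coordinate of that step. -/
def LabelledDyckPath.toParking {n p : ℕ} (D : LabelledDyckPath n p) : parkingFunctions n p :=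
  ⟨fun k => D.path (D.label.symm k), by
    intro l hl hlp
    rcases Nat.eq_zero_or_pos p with rfl | hp
    · omega
    have hcard : (Finset.univ.filter fun k => D.path (D.label.symm k) < l).card =
        (Finset.univ.filter fun i => D.path i < l).card := by
      refine Finset.card_bij (fun k _ => D.label.symm k) ?_ ?_ ?_
      · intro k hk
        simpa using hk
      · intro a _ b _ h
        exact D.label.symm.injective h
      · intro i hi
        exact ⟨D.label i, by simpa using hi, by simp⟩
    rw [hcard]
    by_contra hlt
    push Not at hlt
    set c := (Finset.univ.filter fun i => D.path i < l).card with hc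
    have hcn : c < n := by
      by_contra h
      push Not at h
      have h1 : n * l ≤ n * p := Nat.mul_le_mul_left n hlp
      have h2 : p * n ≤ p * c := Nat.mul_le_mul_left p h
      have h3 : n * p = p * n := Nat.mul_comm n p
      omega
    have hsub : (Finset.univ.filter fun i : Fin n => i ≤ (⟨c, hcn⟩ : Fin n)) ⊆
        (Finset.univ.filter fun i => D.path i < l) := by
      intro i hi
      simp only [Finset.mem_filter, Finset.mem_univ, true_and] at hi ⊢
      refine lt_of_le_of_lt (D.monotone hi) ?_
      have h1 := D.above_diagonal ⟨c, hcn⟩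
      simp only at h1
      exact Nat.lt_of_mul_lt_mul_left (lt_of_le_of_lt h1 hlt)
    have h2 := Finset.card_le_card hsub
    have h3 : (Finset.univ.filter fun i : Fin n => i ≤ (⟨c, hcn⟩ : Fin n)) =
        Finset.Iic ⟨c, hcn⟩ := by
      ext i
      simp
    rw [h3, Fin.card_Iic, ← hc] at h2
    simp at h2⟩

/-! ## Affine permutations -/

theorem periodic_mul {n : ℕ} {σ : Equiv.Perm ℤ} (h : ∀ i, σ (i + n) = σ i + n) (i k : ℤ) :
    σ (i + n * k) = σ i + n * k := by
  induction k using Int.induction_on with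
  | zero => simp
  | succ k ih =>
    rw [show i + n * ((k : ℤ) + 1) = (i + n * k) + n by ring, h, ih]
    ring
  | pred k ih =>
    have := h (i + n * (-(k : ℤ) - 1))
    rw [show i + n * (-(k : ℤ) - 1) + n = i + n * (-(k : ℤ)) by ring, ih] at this
    linarith

theorem sum_shift {n : ℕ} {σ τ : Equiv.Perm ℤ} (hσ : ∀ i, σ (i + n) = σ i + n)
    (hτ : ∀ i, τ (i + n) = τ i + n) :
    ∑ i ∈ Finset.range n, (σ (τ ((i : ℤ) + 1)) - τ ((i : ℤ) + 1)) =
      ∑ i ∈ Finset.range n, (σ ((i : ℤ) + 1) - ((i : ℤ) + 1)) := by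
  rcases Nat.eq_zero_or_pos n with rfl | hn
  · simp
  have hn' : (0 : ℤ) < n := by exact_mod_cast hn
  set r : ℕ → ℕ := fun i => ((τ ((i : ℤ) + 1) - 1) % n).toNat with hr
  have hr0 : ∀ i, ((r i : ℕ) : ℤ) = (τ ((i : ℤ) + 1) - 1) % n := fun i =>
    Int.toNat_of_nonneg (Int.emod_nonneg _ hn'.ne')
  have hr1 : ∀ i : ℕ, τ ((i : ℤ) + 1) = ((r i : ℤ) + 1) + n * ((τ ((i : ℤ) + 1) - 1) / n) := by
    intro i
    have := Int.emod_add_mul_ediv (τ ((i : ℤ) + 1) - 1) n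
    rw [hr0]
    linarith
  have hmem : ∀ i, r i < n := by
    intro i
    have := Int.emod_lt_of_pos (τ ((i : ℤ) + 1) - 1) hn'
    rw [← hr0] at this
    exact_mod_cast this
  have hinj : Set.InjOn r (Finset.range n : Set ℕ) := by
    intro i hi j hj hij
    simp only [Finset.coe_range, Set.mem_Iio] at hi hj
    have h1 := hr1 i
    have h2 := hr1 j
    rw [hij] at h1
    set a := (τ ((i : ℤ) + 1) - 1) / n
    set b := (τ ((j : ℤ) + 1) - 1) / n
    have h3 : τ ((i : ℤ) + 1) = τ ((j : ℤ) + 1 + n * (a - b)) := by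
      rw [periodic_mul hτ, h1, h2]
      ring
    have h4 := τ.injective h3
    have h5 : (i : ℤ) % n = (j : ℤ) % n := by
      rw [show (i : ℤ) = j + n * (a - b) by linarith, Int.add_mul_emod_self_left]
    rw [Int.emod_eq_of_lt (by positivity) (by exact_mod_cast hi),
      Int.emod_eq_of_lt (by positivity) (by exact_mod_cast hj)] at h5
    exact_mod_cast h5
  have himg : (Finset.range n).image r = Finset.range n := by
    refine Finset.eq_of_subset_of_card_le ?_ ?_
    · intro x hx
      obtain ⟨i, _, rfl⟩ := Finset.mem_image.mp hx
      exact Finset.mem_range.mpr (hmem i)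
    · rw [Finset.card_image_of_injOn hinj]
  conv_rhs => rw [← himg]
  rw [Finset.sum_image hinj]
  refine Finset.sum_congr rfl fun i _ => ?_
  conv_lhs => rw [hr1 i, periodic_mul hσ]
  ring

theorem sum_window_id (n : ℕ) :
    ∑ i ∈ Finset.range n, ((i : ℤ) + 1) = ((n + 1).choose 2 : ℕ) := by
  induction n with
  | zero => simp
  | succ n ih =>
    rw [Finset.sum_range_succ, ih, Nat.choose_succ_succ' (n + 1) 1]
    push_cast
    simp
    ring

/-- The affine symmetric group: bijections `σ` of `ℤ` with `σ(i + n) = σ(i) + n` and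
`σ(1) + ⋯ + σ(n) = n (n + 1) / 2`. -/
def affineSymmetricGroup (n : ℕ) : Subgroup (Equiv.Perm ℤ) where
  carrier := {σ | (∀ i, σ (i + n) = σ i + n) ∧
    ∑ i ∈ Finset.range n, σ ((i : ℤ) + 1) = ((n + 1).choose 2 : ℕ)}
  one_mem' := ⟨fun i => rfl, by simpa using sum_window_id n⟩
  mul_mem' {σ τ} hσ hτ := by
    refine ⟨fun i => by simp [hτ.1, hσ.1], ?_⟩
    have h := sum_shift hσ.1 hτ.1
    rw [Finset.sum_sub_distrib, Finset.sum_sub_distrib, hτ.2, hσ.2, sum_window_id] at h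
    simp only [Equiv.Perm.mul_apply]
    linarith
  inv_mem' {σ} hσ := by
    have hp : ∀ i, σ⁻¹ (i + n) = σ⁻¹ i + n := by
      intro i
      apply σ.injective
      rw [hσ.1]
      simp
    refine ⟨hp, ?_⟩
    have h := sum_shift hσ.1 hp
    rw [Finset.sum_sub_distrib, Finset.sum_sub_distrib, hσ.2, sum_window_id] at h
    have h' : ∑ i ∈ Finset.range n, σ (σ⁻¹ ((i : ℤ) + 1)) =
        ∑ i ∈ Finset.range n, ((i : ℤ) + 1) :=
      Finset.sum_congr rfl fun i _ => Equiv.apply_symm_apply σ ((i : ℤ) + 1)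
    rw [h', sum_window_id] at h
    linarith

/-- The affine simple transposition: `i ↦ i + 1` for `i ≡ j`, `i ↦ i - 1` for `i ≡ j + 1`
modulo `n`, and `i ↦ i` otherwise. -/
def affineTransposition (n : ℕ) (j i : ℤ) : ℤ :=
  if i ≡ j [ZMOD n] then i + 1 else if i ≡ j + 1 [ZMOD n] then i - 1 else i

/-- The `p`-stable affine permutations. -/
def stablePerms (n p : ℕ) : Set (affineSymmetricGroup n) :=
  {w | ∀ i : ℤ, (w : Equiv.Perm ℤ) i < (w : Equiv.Perm ℤ) (i + p)}

/-! ## The combinatorial Anderson map of Gorsky, Mazin and Vazirani -/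

/-- The set `Δ_w = {l : w(l) > 0}`. -/
def gaps (w : Equiv.Perm ℤ) : Set ℤ := {l | 0 < w l}

/-- The minimal element of `Δ_w`. -/
def minGap (w : Equiv.Perm ℤ) : ℤ := sInf (gaps w)

/-- The normalised set `Δ_w - M_w`, where `M_w` is the minimal element of `Δ_w`. -/
def normalizedGaps (w : Equiv.Perm ℤ) : Set ℤ := {l | l + minGap w ∈ gaps w}

/-- The label `-n - n x + p y` of the box `(x, y)`. -/
def boxLabel (n p : ℕ) (x y : ℤ) : ℤ := -n - n * x + p * y

/-- The Young diagram of the boxes of the `p × n` rectangle whose labels lie in the normalised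
set. -/
def diagram (n p : ℕ) (w : Equiv.Perm ℤ) : Set (ℤ × ℤ) :=
  {b | 0 ≤ b.1 ∧ b.1 < p ∧ 0 ≤ b.2 ∧ b.2 < n ∧ boxLabel n p b.1 b.2 ∈ normalizedGaps w}

/-- The number of boxes of the diagram in the row with `y`-coordinate `i`, that is, the
`x`-coordinate of the North step of the boundary path in that row. -/
def rowLength (n p : ℕ) (w : Equiv.Perm ℤ) (i : Fin n) : ℕ :=
  {x : ℤ | (x, ((i : ℕ) : ℤ)) ∈ diagram n p w}.ncard

/-- The label of the rightmost box of the diagram in row `i` (rows are left-justified, so this box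
has `x`-coordinate `rowLength - 1`), or the label of the box `(-1, i)` if the row is empty. -/
def rightmostLabel (n p : ℕ) (w : Equiv.Perm ℤ) (i : Fin n) : ℤ :=
  boxLabel n p ((rowLength n p w i : ℤ) - 1) ((i : ℕ) : ℤ)

section GMV

variable {n p : ℕ} {w : affineSymmetricGroup n}

theorem minGap_isLeast (hn : 2 ≤ n) (w : affineSymmetricGroup n) :
    IsLeast (gaps w) (minGap w) := by
  have hn' : (0 : ℤ) < n := by omega
  have hne : (gaps w).Nonempty := ⟨(w : Equiv.Perm ℤ).symm 1, by simp [gaps]⟩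
  have hinv := (w⁻¹ : affineSymmetricGroup n).2.1
  have hb : BddBelow (gaps (w : Equiv.Perm ℤ)) := by
    obtain ⟨B, hB⟩ := ((Set.finite_Icc (1 : ℤ) n).image
      ((w⁻¹ : affineSymmetricGroup n) : Equiv.Perm ℤ)).bddBelow
    refine ⟨B, fun l hl => ?_⟩
    have hl' : 0 < (w : Equiv.Perm ℤ) l := hl
    set m := (w : Equiv.Perm ℤ) l with hm
    have h1 := Int.emod_add_mul_ediv (m - 1) n
    have h2 := Int.emod_nonneg (m - 1) hn'.ne'
    have h3 := Int.emod_lt_of_pos (m - 1) hn'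
    have h4 : 0 ≤ (m - 1) / n := Int.ediv_nonneg (by omega) hn'.le
    have h5 : l = ((w⁻¹ : affineSymmetricGroup n) : Equiv.Perm ℤ) m := by simp [hm]
    have h6 : m = ((m - 1) % n + 1) + n * ((m - 1) / n) := by linarith
    have h7 : l = ((w⁻¹ : affineSymmetricGroup n) : Equiv.Perm ℤ) ((m - 1) % n + 1) +
        n * ((m - 1) / n) := by
      rw [← periodic_mul hinv, ← h6]
      exact h5
    have h8 : B ≤ ((w⁻¹ : affineSymmetricGroup n) : Equiv.Perm ℤ) ((m - 1) % n + 1) :=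
      hB ⟨_, ⟨by omega, by omega⟩, rfl⟩
    have h9 : 0 ≤ (n : ℤ) * ((m - 1) / n) := mul_nonneg hn'.le h4
    linarith
  exact ⟨Int.csInf_mem hne hb, fun l hl => csInf_le hb hl⟩

theorem normalizedGaps_nonneg (hn : 2 ≤ n) {l : ℤ} (h : l ∈ normalizedGaps w) : 0 ≤ l := by
  have := (minGap_isLeast hn w).2 h
  linarith

theorem normalizedGaps_zero (hn : 2 ≤ n) : 0 ∈ normalizedGaps w := by
  simpa [normalizedGaps] using (minGap_isLeast hn w).1

theorem normalizedGaps_add_n (k : ℕ) {l : ℤ} (h : l ∈ normalizedGaps w) :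
    l + n * k ∈ normalizedGaps w := by
  have h' : 0 < (w : Equiv.Perm ℤ) (l + minGap w) := h
  change 0 < (w : Equiv.Perm ℤ) (l + n * k + minGap w)
  rw [show l + n * k + minGap w = l + minGap w + n * k by ring, periodic_mul w.2.1]
  positivity

theorem normalizedGaps_add_p (hw : w ∈ stablePerms n p) (k : ℕ) {l : ℤ}
    (h : l ∈ normalizedGaps w) : l + p * k ∈ normalizedGaps w := by
  induction k with
  | zero => simpa using h
  | succ k ih =>
    have h' : 0 < (w : Equiv.Perm ℤ) (l + p * k + minGap w) := ih
    change 0 < (w : Equiv.Perm ℤ) (l + p * (k + 1 : ℕ) + minGap w)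
    have := hw (l + p * k + minGap w)
    rw [show l + p * (k + 1 : ℕ) + minGap w = l + p * k + minGap w + p by push_cast; ring]
    exact h'.trans this

/-- Rows of the diagram are left-justified. -/
theorem mem_row_iff (hn : 2 ≤ n) (i : Fin n) (x : ℕ) :
    boxLabel n p x (i : ℕ) ∈ normalizedGaps w ↔ x < rowLength n p w i := by
  classical
  have hex : ∃ m : ℕ, boxLabel n p m (i : ℕ) ∉ normalizedGaps w := by
    refine ⟨p * i, fun h => ?_⟩
    have h1 := normalizedGaps_nonneg hn h
    simp only [boxLabel] at h1
    push_cast at h1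
    have h2 : (0 : ℤ) ≤ p * (i : ℕ) := by positivity
    have h3 : (2 : ℤ) ≤ n := by exact_mod_cast hn
    nlinarith
  have hlt : ∀ x : ℕ, boxLabel n p x (i : ℕ) ∈ normalizedGaps w ↔ x < Nat.find hex := by
    intro x
    refine ⟨fun h => ?_, fun h => not_not.mp (Nat.find_min hex h)⟩
    by_contra hx
    push Not at hx
    refine Nat.find_spec hex ?_
    have := normalizedGaps_add_n (x - Nat.find hex) h
    rw [Nat.cast_sub hx] at this
    convert this using 1
    generalize Nat.find hex = m
    simp only [boxLabel]
    ring
  have hrow : {x : ℤ | (x, ((i : ℕ) : ℤ)) ∈ diagram n p w} =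
      (fun k : ℕ => (k : ℤ)) '' (Finset.range (Nat.find hex) : Set ℕ) := by
    ext y
    constructor
    · rintro ⟨h0, _, _, _, h⟩
      simp only at h0 h
      obtain ⟨k, rfl⟩ := Int.eq_ofNat_of_zero_le h0
      exact ⟨k, by simpa using (hlt k).mp h, rfl⟩
    · rintro ⟨k, hk, rfl⟩
      have hk' := (hlt k).mpr (by simpa using hk)
      have h1 := normalizedGaps_nonneg hn hk'
      refine ⟨by simp, ?_, by simp, Int.ofNat_lt.mpr i.2, hk'⟩
      simp only [boxLabel] at h1 ⊢
      have h2 : ((i : ℕ) : ℤ) < n := by exact_mod_cast i.2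
      by_contra hge
      push Not at hge
      have h3 : (n : ℤ) * p ≤ n * k := mul_le_mul_of_nonneg_left hge (by positivity)
      have h4 : (p : ℤ) * (i : ℕ) ≤ p * n := mul_le_mul_of_nonneg_left h2.le (by positivity)
      have h5 : (p : ℤ) * n = n * p := mul_comm _ _
      omega
  rw [hlt, rowLength, hrow, Set.ncard_image_of_injective _ Nat.cast_injective]
  simp

theorem rightmostLabel_eq (i : Fin n) :
    rightmostLabel n p w i = p * (i : ℕ) - n * rowLength n p w i := by
  simp only [rightmostLabel, boxLabel]
  ring

theorem rightmostLabel_mem (hn : 2 ≤ n) (hw : w ∈ stablePerms n p) (i : Fin n) :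
    rightmostLabel n p w i ∈ normalizedGaps w := by
  rcases Nat.eq_zero_or_pos (rowLength n p w i) with h | h
  · rw [rightmostLabel_eq, h]
    simpa using normalizedGaps_add_p hw i (normalizedGaps_zero hn)
  · have := (mem_row_iff (p := p) (w := w) hn i (rowLength n p w i - 1)).mpr (by omega)
    rw [rightmostLabel]
    rwa [Nat.cast_sub (by omega), Nat.cast_one] at this

theorem rightmostLabel_sub_notMem (hn : 2 ≤ n) (i : Fin n) :
    rightmostLabel n p w i - n ∉ normalizedGaps w := by
  have := (mem_row_iff (p := p) (w := w) hn i (rowLength n p w i)).not.mpr (lt_irrefl _)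
  convert this using 2
  rw [rightmostLabel_eq, boxLabel]
  ring

theorem labelValue_bounds (hn : 2 ≤ n) (hw : w ∈ stablePerms n p) (i : Fin n) :
    0 < (w : Equiv.Perm ℤ) (rightmostLabel n p w i + minGap w) ∧
      (w : Equiv.Perm ℤ) (rightmostLabel n p w i + minGap w) ≤ n := by
  refine ⟨rightmostLabel_mem hn hw i, ?_⟩
  have h : ¬ 0 < (w : Equiv.Perm ℤ) (rightmostLabel n p w i - n + minGap w) :=
    rightmostLabel_sub_notMem hn i
  have h2 := w.2.1 (rightmostLabel n p w i - n + minGap w)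
  rw [show rightmostLabel n p w i - n + minGap w + n = rightmostLabel n p w i + minGap w by
    ring] at h2
  linarith

/-- The label `w(l_i + M_w)` of the North step in row `i`, a number in `{1, …, n}`, encoded as the
element `w(l_i + M_w) - 1` of `Fin n`. -/
def stepLabel (hn : 2 ≤ n) (hw : w ∈ stablePerms n p) (i : Fin n) : Fin n :=
  ⟨((w : Equiv.Perm ℤ) (rightmostLabel n p w i + minGap w) - 1).toNat, by
    have := labelValue_bounds hn hw i
    omega⟩

theorem stepLabel_val (hn : 2 ≤ n) (hw : w ∈ stablePerms n p) (i : Fin n) :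
    ((stepLabel hn hw i : ℕ) : ℤ) =
      (w : Equiv.Perm ℤ) (rightmostLabel n p w i + minGap w) - 1 := by
  have := labelValue_bounds hn hw i
  simp only [stepLabel]
  omega

theorem stepLabel_injective (hn : 2 ≤ n) (hpn : p.Coprime n) (hw : w ∈ stablePerms n p) :
    Function.Injective (stepLabel hn hw) := by
  intro i j hij
  have h1 := stepLabel_val hn hw i
  have h2 := stepLabel_val hn hw j
  rw [hij] at h1
  have h3 : rightmostLabel n p w i + minGap w = rightmostLabel n p w j + minGap w :=
    (w : Equiv.Perm ℤ).injective (by linarith)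
  have h4 : (n : ℤ) ∣ p * (((i : ℕ) : ℤ) - (j : ℕ)) := by
    rw [rightmostLabel_eq, rightmostLabel_eq] at h3
    exact ⟨(rowLength n p w i : ℤ) - rowLength n p w j, by linarith⟩
  have h5 : (n : ℤ) ∣ ((i : ℕ) : ℤ) - (j : ℕ) :=
    IsCoprime.dvd_of_dvd_mul_left (Nat.isCoprime_iff_coprime.mpr hpn.symm) h4
  have h6 := Int.eq_zero_of_abs_lt_dvd h5 (by
    have := i.2
    have := j.2
    rw [abs_lt]
    constructor <;> omega)
  exact Fin.ext (by omega)

/-- The combinatorial Anderson map `w ↦ (P_w, σ)`. -/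
def combinatorialAnderson (hn : 2 ≤ n) (hpn : p.Coprime n) (w : stablePerms n p) :
    LabelledDyckPath n p where
  path := rowLength n p w.1
  monotone i j hij := by
    by_contra hlt
    push Not at hlt
    refine rightmostLabel_sub_notMem (p := p) (w := w.1) hn j ?_
    have h1 := normalizedGaps_add_n (rowLength n p w.1 i - rowLength n p w.1 j - 1)
      (normalizedGaps_add_p w.2 (j - i : ℕ) (rightmostLabel_mem hn w.2 i))
    convert h1 using 1
    rw [rightmostLabel_eq, rightmostLabel_eq, Nat.cast_sub (Fin.le_def.mp hij), Nat.sub_sub,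
      Nat.cast_sub (by omega)]
    push_cast
    ring
  above_diagonal i := by
    have h := normalizedGaps_nonneg hn (rightmostLabel_mem hn w.2 i)
    rw [rightmostLabel_eq] at h
    have : (n : ℤ) * rowLength n p w.1 i ≤ p * (i : ℕ) := by linarith
    exact_mod_cast this
  label := Equiv.ofBijective (stepLabel hn w.2)
    (Finite.injective_iff_bijective.mp (stepLabel_injective hn hpn w.2))
  rise i j hij hP := by
    rw [Equiv.ofBijective_apply, Equiv.ofBijective_apply, Fin.lt_def]
    have h1 := stepLabel_val hn w.2 i
    have h2 := stepLabel_val hn w.2 j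
    have h3 := w.2 (rightmostLabel n p w.1 i + minGap w.1)
    rw [show rightmostLabel n p w.1 i + minGap w.1 + p = rightmostLabel n p w.1 j + minGap w.1 by
      rw [rightmostLabel_eq, rightmostLabel_eq, ← hP, hij]
      push_cast
      ring] at h3
    omega

end GMV

end Anderson

end

open Anderson

noncomputable section

namespace Anderson

/-! ## Unrolling a vector to a function on the integers -/

section Unroll

variable {n : ℕ} (hn : 2 ≤ n)

/-! Extend a vector `x` of the hyperplane to a function on `ℤ` by `x (i + n) = x i - 1`. Each
reflection of the affine Weyl group then only permutes the values of this function: `g` corresponds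
to `σ` when `(g x) (σ i) = x i` for all `x` and `i` (`Intertwines`). This relation is the graph of a
group isomorphism, `weylEquiv`. The map `g` determines `σ` because the unrolled barycenter takes
pairwise distinct values, and `σ` determines `g` because the unrolled values determine the point.

In this language all the data become statements about integers. An affine root is a pair `(i, j)` of
integers with distinct residues, up to a simultaneous shift by `n`. Its height is `j - i`, it is
positive exactly when `i < j`, and the group moves both entries by `σ`; so `p`-stability says `σ i <
σ (i + p)` (`mem_stable_iff`). The Sommers region is `x (i + p) < x i` for all `i`
(`mem_sommersRegion_iff`), and the dilated alcove is `x 1 > ⋯ > x n > x 1 - p`. Sampling `x` along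
the progression `p + c, 2 p + c, …, n p + c` turns the first system of inequalities into the second,
so the Sommers element is the inverse of `slopePerm`. It is unique because only the identity
preserves the Sommers region (`eq_one_of_preserves_sommersRegion`).

The comparison is then one congruence (`piTorus_uniformAnderson`). Let `w` be the permutation of `g`
and `s` the slope permutation. If `w (s (j + n q)) = k` with `1 ≤ j ≤ n`, then coordinate `k` of `g
g_p⁻¹ 0` is `-q`. The Gorsky–Mazin–Vazirani construction gives `w (p i - n f_k + M) = k`. Hence `p j
+ c + n q = p i - n f_k + M`, so modulo `p` the values `f_k` and `-q` differ by `(M - c) / n`, which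
does not depend on `k` and dies in the quotient by `(1, …, 1)`.

Bijectivity of the two projections is separate: Bézout for the torus, and a cycle-lemma argument for
parking functions. -/

/-- The coordinate index (starting at `0`) of an integer `i`, where `1, …, n` are the standard
representatives. -/
def residue (i : ℤ) : Fin n :=
  ⟨((i - 1) % n).toNat, by
    have hn' := hn
    have h1 := Int.emod_nonneg (i - 1) (b := (n : ℤ)) (by omega)
    have h2 := Int.emod_lt_of_pos (i - 1) (b := (n : ℤ)) (by omega)
    omega⟩

theorem residue_val (i : ℤ) : ((residue hn i : ℕ) : ℤ) = (i - 1) % n :=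
  Int.toNat_of_nonneg (Int.emod_nonneg _ (by omega))

theorem residue_add_ediv (i : ℤ) : i = (residue hn i : ℕ) + 1 + n * ((i - 1) / n) := by
  have := Int.emod_add_mul_ediv (i - 1) n
  rw [residue_val]
  linarith

theorem window_ediv (k : Fin n) (q : ℤ) : (((k : ℕ) : ℤ) + 1 + n * q - 1) / n = q := by
  have h0 : (n : ℤ) ≠ 0 := by have := k.2; omega
  rw [show ((k : ℕ) : ℤ) + 1 + n * q - 1 = (k : ℕ) + n * q by ring, Int.add_mul_ediv_left _ _ h0,
    Int.ediv_eq_zero_of_lt (by positivity) (by exact_mod_cast k.2), zero_add]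

theorem residue_window (k : Fin n) (q : ℤ) : residue hn ((k : ℕ) + 1 + n * q) = k := by
  have h := residue_add_ediv hn ((k : ℕ) + 1 + n * q)
  rw [window_ediv] at h
  exact Fin.ext (by omega)

theorem residue_window_zero (k : Fin n) : residue hn ((k : ℕ) + 1) = k := by
  simpa using residue_window hn k 0

theorem exists_window (hn : 2 ≤ n) (i : ℤ) : ∃ (k : Fin n) (q : ℤ), i = (k : ℕ) + 1 + n * q :=
  ⟨residue hn i, (i - 1) / n, residue_add_ediv hn i⟩

theorem residue_add_mul (i q : ℤ) : residue hn (i + n * q) = residue hn i := by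
  obtain ⟨k, r, rfl⟩ := exists_window hn i
  rw [show ((k : ℕ) : ℤ) + 1 + n * r + n * q = (k : ℕ) + 1 + n * (r + q) by ring,
    residue_window, residue_window]

theorem residue_eq_residue_iff (i j : ℤ) : residue hn i = residue hn j ↔ ∃ q : ℤ, j = i + n * q := by
  refine ⟨fun h => ⟨(j - 1) / n - (i - 1) / n, ?_⟩, ?_⟩
  · have h1 := residue_add_ediv hn i
    have h2 := residue_add_ediv hn j
    rw [← h] at h2
    linarith
  · rintro ⟨q, rfl⟩
    rw [residue_add_mul]

/-- The extension of `(x₁, …, xₙ)` to a function on `ℤ` with `x (i + n) = x i - 1`. -/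
def unroll (x : hyper n) (i : ℤ) : ℝ := x.1 (residue hn i) - ((i - 1) / n : ℤ)

theorem unroll_window (x : hyper n) (k : Fin n) (q : ℤ) :
    unroll hn x ((k : ℕ) + 1 + n * q) = x.1 k - q := by
  rw [unroll, residue_window, window_ediv]

theorem unroll_window_zero (x : hyper n) (k : Fin n) : unroll hn x ((k : ℕ) + 1) = x.1 k := by
  simpa using unroll_window hn x k 0

theorem unroll_add_mul (x : hyper n) (i q : ℤ) :
    unroll hn x (i + n * q) = unroll hn x i - q := by
  obtain ⟨k, r, rfl⟩ := exists_window hn i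
  rw [show ((k : ℕ) : ℤ) + 1 + n * r + n * q = (k : ℕ) + 1 + n * (r + q) by ring,
    unroll_window, unroll_window]
  push_cast
  ring

theorem unroll_injective {x y : hyper n} (h : ∀ i, unroll hn x i = unroll hn y i) : x = y := by
  apply Subtype.ext
  ext k
  simpa only [unroll_window_zero] using h ((k : ℕ) + 1)

theorem sum_fin_succ (n : ℕ) : ∑ k : Fin n, (((k : ℕ) : ℝ) + 1) = n * (n + 1) / 2 := by
  rw [Fin.sum_univ_eq_sum_range (fun i : ℕ => (i : ℝ) + 1) n]
  induction n with
  | zero => simp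
  | succ n ih =>
    rw [Finset.sum_range_succ, ih]
    push_cast
    ring

/-- The point whose unrolled function is `i ↦ -i / n` up to a constant. -/
def barycenter (n : ℕ) : hyper n :=
  ⟨WithLp.toLp 2 fun k => ((n : ℝ) + 1) / (2 * n) - ((k : ℕ) + 1) / n, by
    change ∑ k : Fin n, (((n : ℝ) + 1) / (2 * n) - ((k : ℕ) + 1) / n) = 0
    simp only [Finset.sum_sub_distrib, ← Finset.sum_div, sum_fin_succ]
    rcases Nat.eq_zero_or_pos n with rfl | h
    · simp
    · have : (n : ℝ) ≠ 0 := by positivity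
      simp
      field_simp
      ring⟩

theorem unroll_barycenter (i : ℤ) :
    unroll hn (barycenter n) i = ((n : ℝ) + 1) / (2 * n) - i / n := by
  have : (n : ℝ) ≠ 0 := by positivity
  obtain ⟨k, q, rfl⟩ := exists_window hn i
  rw [unroll_window]
  simp only [barycenter]
  push_cast
  field_simp
  ring

theorem unroll_barycenter_injective : Function.Injective (unroll hn (barycenter n)) := by
  intro i j h
  have : (n : ℝ) ≠ 0 := by positivity
  rw [unroll_barycenter, unroll_barycenter] at h
  field_simp at h
  have h' : (i : ℝ) = j := by linarith
  exact_mod_cast h'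

end Unroll

/-! ## Affine maps and affine permutations -/

section Intertwines

variable {n : ℕ} (hn : 2 ≤ n)

/-- The affine map `g` permutes the unrolled coordinates by `σ`. -/
def Intertwines (g : hyper n ≃ᵃ[ℝ] hyper n) (σ : Equiv.Perm ℤ) : Prop :=
  ∀ x i, unroll hn (g x) (σ i) = unroll hn x i

variable {hn}

theorem Intertwines.mul {g g' : hyper n ≃ᵃ[ℝ] hyper n} {σ σ' : Equiv.Perm ℤ}
    (h : Intertwines hn g σ) (h' : Intertwines hn g' σ') : Intertwines hn (g * g') (σ * σ') :=
  fun x i => (h (g' x) (σ' i)).trans (h' x i)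

theorem Intertwines.inv {g : hyper n ≃ᵃ[ℝ] hyper n} {σ : Equiv.Perm ℤ}
    (h : Intertwines hn g σ) : Intertwines hn g⁻¹ σ⁻¹ := by
  intro x i
  have := h (g⁻¹ x) (σ⁻¹ i)
  rw [show g (g⁻¹ x) = x from g.apply_symm_apply x,
    show σ (σ⁻¹ i) = i from σ.apply_symm_apply i] at this
  exact this.symm

theorem Intertwines.one : Intertwines hn 1 1 := fun _ _ => rfl

/-- The unrolled barycenter has pairwise distinct values, so the value found at position `i` of its
image under `g` reveals `σ⁻¹ i`. -/
theorem Intertwines.perm_eq {g : hyper n ≃ᵃ[ℝ] hyper n} {σ σ' : Equiv.Perm ℤ}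
    (h : Intertwines hn g σ) (h' : Intertwines hn g σ') : σ = σ' := by
  refine inv_injective (Equiv.ext fun i => unroll_barycenter_injective hn ?_)
  have e1 := h (barycenter n) (σ⁻¹ i)
  have e2 := h' (barycenter n) (σ'⁻¹ i)
  rw [show σ (σ⁻¹ i) = i from σ.apply_symm_apply i] at e1
  rw [show σ' (σ'⁻¹ i) = i from σ'.apply_symm_apply i] at e2
  rw [← e1, e2]

theorem Intertwines.map_eq {g g' : hyper n ≃ᵃ[ℝ] hyper n} {σ : Equiv.Perm ℤ}
    (h : Intertwines hn g σ) (h' : Intertwines hn g' σ) : g = g' := by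
  ext1 x
  refine unroll_injective hn fun i => ?_
  rw [← σ.apply_symm_apply i, h, h']

theorem sum_window_fin (f : ℤ → ℤ) :
    ∑ i ∈ Finset.range n, f ((i : ℤ) + 1) = ∑ k : Fin n, f ((k : ℕ) + 1) :=
  (Fin.sum_univ_eq_sum_range (fun i : ℕ => f ((i : ℤ) + 1)) n).symm

theorem affReflection_eDiff_apply {a b : Fin n} (hab : a ≠ b) (k : ℤ) (x : hyper n) (c : Fin n) :
    (affReflection (eDiff a b) k x).1 c =
      if c = a then x.1 b + k else if c = b then x.1 a - k else x.1 c := by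
  rw [affReflection_apply, eDiff_inner_self hab, inner_eDiff]
  simp only [Submodule.coe_sub, Submodule.coe_smul, PiLp.sub_apply, PiLp.smul_apply, eDiff_apply,
    smul_eq_mul]
  by_cases h1 : c = a
  · subst h1
    simp [hab]
    ring
  · by_cases h2 : c = b
    · subst h2
      simp [h1]
      ring
    · simp [h1, h2]

variable (hn) in
/-- The underlying function of the affine transposition attached to a reflection. -/
def transpositionFun (a b : Fin n) (k i : ℤ) : ℤ :=
  if residue hn i = a then i + ((b : ℕ) - (a : ℕ) - n * k)
  else if residue hn i = b then i - ((b : ℕ) - (a : ℕ) - n * k) else i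

theorem transpositionFun_left (a b : Fin n) (k q : ℤ) :
    transpositionFun hn a b k ((a : ℕ) + 1 + n * q) = (b : ℕ) + 1 + n * (q - k) := by
  rw [transpositionFun, if_pos (residue_window hn a q)]
  ring

theorem transpositionFun_right {a b : Fin n} (hab : a ≠ b) (k q : ℤ) :
    transpositionFun hn a b k ((b : ℕ) + 1 + n * q) = (a : ℕ) + 1 + n * (q + k) := by
  rw [transpositionFun, residue_window, if_neg hab.symm, if_pos rfl]
  ring

theorem transpositionFun_other {a b c : Fin n} (ha : c ≠ a) (hb : c ≠ b) (k q : ℤ) :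
    transpositionFun hn a b k ((c : ℕ) + 1 + n * q) = (c : ℕ) + 1 + n * q := by
  rw [transpositionFun, residue_window, if_neg ha, if_neg hb]

theorem transpositionFun_involutive {a b : Fin n} (hab : a ≠ b) (k : ℤ) :
    Function.Involutive (transpositionFun hn a b k) := by
  intro i
  obtain ⟨c, q, rfl⟩ := exists_window hn i
  by_cases ha : c = a
  · subst ha
    rw [transpositionFun_left, transpositionFun_right hab]
    ring
  · by_cases hb : c = b
    · subst hb
      rw [transpositionFun_right hab, transpositionFun_left]
      ring
    · rw [transpositionFun_other ha hb, transpositionFun_other ha hb]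

variable (hn) in
/-- The affine transposition attached to the reflection in `⟨x, e_a - e_b⟩ = k`. -/
def transposition {a b : Fin n} (hab : a ≠ b) (k : ℤ) : affineSymmetricGroup n :=
  ⟨(transpositionFun_involutive (hn := hn) hab k).toPerm, by
    constructor
    · intro i
      simp only [Function.Involutive.coe_toPerm, transpositionFun]
      have := residue_add_mul hn i 1
      rw [mul_one] at this
      rw [this]
      split_ifs <;> ring
    · rw [← sum_window_id]
      simp only [Function.Involutive.coe_toPerm]
      rw [sum_window_fin (transpositionFun hn a b k), sum_window_fin (fun i => i)]
      simp only [transpositionFun, residue_window_zero]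
      rw [← sub_eq_zero, ← Finset.sum_sub_distrib]
      -- The displacements at `a` and at `b` are opposite, so the window sum does not change.
      rw [Finset.sum_congr rfl (g := fun c : Fin n =>
        (if c = a then ((b : ℕ) - (a : ℕ) - n * k : ℤ) else 0) -
        (if c = b then ((b : ℕ) - (a : ℕ) - n * k : ℤ) else 0))]
      · simp [Finset.sum_sub_distrib]
      · intro c _
        by_cases ha : c = a
        · subst ha; simp [hab]
        · by_cases hb : c = b <;> simp [ha, hb, hab.symm]⟩

theorem transposition_apply {a b : Fin n} (hab : a ≠ b) (k i : ℤ) :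
    (transposition hn hab k : Equiv.Perm ℤ) i = transpositionFun hn a b k i := rfl

/-- The reflection exchanges coordinates `a` and `b` up to `±k`, and a change of value by `k` is the
same as a change of index by `-n k` in the unrolled function. -/
theorem intertwines_affReflection {a b : Fin n} (hab : a ≠ b) (k : ℤ) :
    Intertwines hn (affReflection (eDiff a b) k) (transposition hn hab k) := by
  intro x i
  obtain ⟨c, q, rfl⟩ := exists_window hn i
  rw [transposition_apply]
  by_cases ha : c = a
  · subst ha
    rw [transpositionFun_left, unroll_window, unroll_window, affReflection_eDiff_apply hab,
      if_neg hab.symm, if_pos rfl]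
    push_cast
    ring
  · by_cases hb : c = b
    · subst hb
      rw [transpositionFun_right hab, unroll_window, unroll_window, affReflection_eDiff_apply hab,
        if_pos rfl]
      push_cast
      ring
    · rw [transpositionFun_other ha hb, unroll_window, unroll_window,
        affReflection_eDiff_apply hab, if_neg ha, if_neg hb]

theorem exists_perm_of_mem {g : hyper n ≃ᵃ[ℝ] hyper n} (hg : g ∈ (typeA n hn).affineWeylGroup) :
    ∃ σ : affineSymmetricGroup n, Intertwines hn g σ := by
  induction hg using Subgroup.closure_induction with
  | mem g hg =>
    obtain ⟨_, ⟨a, b, hab, rfl⟩, k, rfl⟩ := hg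
    exact ⟨_, intertwines_affReflection hab k⟩
  | one => exact ⟨1, Intertwines.one⟩
  | mul g g' _ _ h h' =>
    obtain ⟨σ, hσ⟩ := h
    obtain ⟨σ', hσ'⟩ := h'
    exact ⟨σ * σ', hσ.mul hσ'⟩
  | inv g _ h =>
    obtain ⟨σ, hσ⟩ := h
    exact ⟨σ⁻¹, hσ.inv⟩

theorem affReflection_eDiff_mem {a b : Fin n} (hab : a ≠ b) (k : ℤ) :
    affReflection (eDiff a b) k ∈ (typeA n hn).affineWeylGroup :=
  Subgroup.subset_closure ⟨_, ⟨a, b, hab, rfl⟩, k, rfl⟩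

theorem exists_mem_permuting (π : Equiv.Perm (Fin n)) :
    ∃ g ∈ (typeA n hn).affineWeylGroup, ∀ x k, (g x).1 (π k) = x.1 k := by
  induction π using Equiv.Perm.swap_induction_on with
  | one => exact ⟨1, Subgroup.one_mem _, fun _ _ => rfl⟩
  | swap_mul π a b hab ih =>
    obtain ⟨g, hg, h⟩ := ih
    refine ⟨affReflection (eDiff a b) 0 * g,
      Subgroup.mul_mem _ (affReflection_eDiff_mem hab 0) hg, fun x k => ?_⟩
    rw [← h x k]
    change (affReflection (eDiff a b) 0 (g x)).1 (Equiv.swap a b (π k)) = _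
    generalize g x = y, π k = m
    rw [affReflection_eDiff_apply hab]
    by_cases h1 : m = a
    · subst h1
      simp [hab.symm]
    · by_cases h2 : m = b
      · subst h2
        simp
      · simp [Equiv.swap_apply_of_ne_of_ne h1 h2, h1, h2]

theorem exists_mem_translating {v : hyper n} (hv : v ∈ (typeA n hn).corootLattice) :
    ∃ g ∈ (typeA n hn).affineWeylGroup, ∀ x, g x = x + v := by
  induction hv using AddSubgroup.closure_induction with
  | mem v hv =>
    obtain ⟨_, ⟨a, b, hab, rfl⟩, rfl⟩ := hv
    -- Reflecting successively in the parallel hyperplanes at levels 0 and 1 translates by the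
    -- coroot.
    refine ⟨affReflection (eDiff a b) 1 * affReflection (eDiff a b) 0,
      Subgroup.mul_mem _ (affReflection_eDiff_mem hab 1) (affReflection_eDiff_mem hab 0),
      fun x => ?_⟩
    apply Subtype.ext
    ext c
    change (affReflection (eDiff a b) 1 (affReflection (eDiff a b) 0 x)).1 c = _
    rw [coroot, eDiff_inner_self hab, div_self two_ne_zero, one_smul, Submodule.coe_add,
      PiLp.add_apply, eDiff_apply]
    simp only [affReflection_eDiff_apply hab]
    by_cases ha : c = a
    · subst ha
      simp [hab, hab.symm]
    · by_cases hb : c = b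
      · subst hb
        simp [hab.symm]
        ring
      · simp [ha, hb]
  | zero => exact ⟨1, Subgroup.one_mem _, fun x => (add_zero x).symm⟩
  | add v v' _ _ h h' =>
    obtain ⟨g, hg, h⟩ := h
    obtain ⟨g', hg', h'⟩ := h'
    refine ⟨g * g', Subgroup.mul_mem _ hg hg', fun x => ?_⟩
    change g (g' x) = _
    rw [h, h']
    abel
  | neg v _ h =>
    obtain ⟨g, hg, h⟩ := h
    refine ⟨g⁻¹, Subgroup.inv_mem _ hg, fun x => ?_⟩
    apply g.injective
    rw [show g (g⁻¹ x) = x from g.apply_symm_apply x, h]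
    abel

/-- Integer vectors with coordinate sum zero lie in the coroot lattice. -/
theorem mem_corootLattice_of_int {x : hyper n} (z : Fin n → ℤ) (hz : ∀ k, x.1 k = z k) :
    x ∈ (typeA n hn).corootLattice := by
  have h0 : 0 < n := by omega
  have hx : x = ∑ k, z k • eDiff k ⟨0, h0⟩ := by
    apply Subtype.ext
    ext k
    have hs : ∑ k, (z k : ℝ) = 0 := by
      have : ∑ k, x.1 k = 0 := x.2
      simpa only [hz] using this
    simp only [← Int.cast_smul_eq_zsmul ℝ, Submodule.coe_sum, Submodule.coe_smul, WithLp.ofLp_sum,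
      Finset.sum_apply, WithLp.ofLp_smul, Pi.smul_apply, eDiff_apply, smul_eq_mul, mul_sub,
      Finset.sum_sub_distrib, ← Finset.sum_mul, hs]
    simp [hz]
  rw [hx]
  refine AddSubgroup.sum_mem _ fun k _ => AddSubgroup.zsmul_mem _ ?_ _
  by_cases hk : k = ⟨0, h0⟩
  · rw [hk, eDiff_self]
    exact AddSubgroup.zero_mem _
  · refine AddSubgroup.subset_closure ⟨eDiff k ⟨0, h0⟩, ⟨k, _, hk, rfl⟩, ?_⟩
    rw [coroot, eDiff_inner_self hk, div_self two_ne_zero, one_smul]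

theorem residue_map_eq {σ : Equiv.Perm ℤ} (hσ : ∀ i, σ (i + n) = σ i + n) {i j : ℤ}
    (h : residue hn i = residue hn j) : residue hn (σ i) = residue hn (σ j) := by
  obtain ⟨q, rfl⟩ := (residue_eq_residue_iff hn i j).mp h
  rw [periodic_mul hσ, residue_add_mul]

theorem residue_map_eq_iff (σ : affineSymmetricGroup n) {i j : ℤ} :
    residue hn ((σ : Equiv.Perm ℤ) i) = residue hn ((σ : Equiv.Perm ℤ) j) ↔
      residue hn i = residue hn j := by
  refine ⟨fun h => ?_, residue_map_eq σ.2.1⟩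
  have := residue_map_eq (σ⁻¹ : affineSymmetricGroup n).2.1 h
  simpa using this

/-- Writing the window as `σ k = π k + n q_k` splits `σ` into the finite permutation `π` followed by
the translation with coordinate `q_k` at `π k`. The normalisation of the window sum says `∑ q_k =
0`, which is what puts this translation vector in the coroot lattice. -/
theorem exists_mem_of_perm (σ : affineSymmetricGroup n) :
    ∃ g ∈ (typeA n hn).affineWeylGroup, Intertwines hn g σ := by
  set r : Fin n → Fin n := fun k => residue hn ((σ : Equiv.Perm ℤ) ((k : ℕ) + 1)) with hr
  have hinj : Function.Injective r := by
    intro k l h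
    have := (residue_map_eq_iff σ).mp h
    rwa [residue_window_zero, residue_window_zero] at this
  let π : Equiv.Perm (Fin n) := Equiv.ofBijective r (Finite.injective_iff_bijective.mp hinj)
  set q : Fin n → ℤ := fun k => ((σ : Equiv.Perm ℤ) ((k : ℕ) + 1) - 1) / n with hq
  have hσ : ∀ k : Fin n, (σ : Equiv.Perm ℤ) ((k : ℕ) + 1) = ((π k : Fin n) : ℕ) + 1 + n * q k :=
    fun k => residue_add_ediv hn _
  have hsum : ∑ k, q k = 0 := by
    have h1 := σ.2.2
    rw [← sum_window_id, sum_window_fin (fun i => (σ : Equiv.Perm ℤ) i),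
      sum_window_fin (fun i => i)] at h1
    simp only [hσ] at h1
    rw [Finset.sum_add_distrib, ← Finset.mul_sum,
      Equiv.sum_comp π (fun k : Fin n => ((k : ℕ) : ℤ) + 1)] at h1
    have h2 : (n : ℤ) * ∑ k, q k = 0 := by linarith
    rcases mul_eq_zero.mp h2 with h | h
    · omega
    · exact h
  have hsum' : ∑ k, ((q (π.symm k) : ℤ) : ℝ) = 0 := by
    rw [Equiv.sum_comp π.symm (fun k => ((q k : ℤ) : ℝ))]
    exact_mod_cast hsum
  obtain ⟨g, hg, hgx⟩ := exists_mem_permuting (hn := hn) π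
  obtain ⟨t, ht, htx⟩ := exists_mem_translating (hn := hn)
    (v := ⟨WithLp.toLp 2 fun k => ((q (π.symm k) : ℤ) : ℝ), hsum'⟩)
    (mem_corootLattice_of_int (fun k => q (π.symm k)) fun k => rfl)
  refine ⟨t * g, Subgroup.mul_mem _ ht hg, fun x i => ?_⟩
  obtain ⟨k, m, rfl⟩ := exists_window hn i
  rw [periodic_mul σ.2.1, hσ, add_assoc, ← mul_add, unroll_window, unroll_window]
  change (t (g x)).1 (π k) - _ = _
  rw [htx, Submodule.coe_add, PiLp.add_apply, hgx]
  simp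
  ring

variable (hn) in
/-- The isomorphism between the affine Weyl group of type `A_{n-1}` and the affine symmetric
group. -/
def weylEquiv : (typeA n hn).affineWeylGroup ≃* affineSymmetricGroup n where
  toFun g := (exists_perm_of_mem g.2).choose
  invFun σ := ⟨_, (exists_mem_of_perm (hn := hn) σ).choose_spec.1⟩
  left_inv g := Subtype.ext
    ((exists_mem_of_perm (exists_perm_of_mem g.2).choose).choose_spec.2.map_eq
      (exists_perm_of_mem g.2).choose_spec)
  right_inv σ := Subtype.ext
    ((exists_perm_of_mem (exists_mem_of_perm (hn := hn) σ).choose_spec.1).choose_spec.perm_eq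
      (exists_mem_of_perm σ).choose_spec.2)
  map_mul' g g' := Subtype.ext
    ((exists_perm_of_mem (g * g').2).choose_spec.perm_eq
      ((exists_perm_of_mem g.2).choose_spec.mul (exists_perm_of_mem g'.2).choose_spec))

theorem intertwines_weylEquiv (g : (typeA n hn).affineWeylGroup) :
    Intertwines hn g (weylEquiv hn g : Equiv.Perm ℤ) :=
  (exists_perm_of_mem g.2).choose_spec

theorem weylEquiv_eq {g : (typeA n hn).affineWeylGroup} {σ : affineSymmetricGroup n}
    (h : Intertwines hn g σ) : weylEquiv hn g = σ :=
  Subtype.ext ((intertwines_weylEquiv g).perm_eq h)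

end Intertwines

/-! ## Heights and positivity in type `A_{n-1}` -/

section TypeA

variable {n : ℕ} {hn : 2 ≤ n}

theorem simple_eq (i : Fin (n - 1)) : (typeA n hn).simple i = simpleVec n i :=
  Module.Basis.mk_apply (simpleVec_linearIndependent n) (simpleVec_span n) i

/-- The height as a linear combination of the coordinates. -/
def heightFunctional (n : ℕ) : hyper n →ₗ[ℝ] ℝ where
  toFun x := -∑ k : Fin n, ((k : ℕ) : ℝ) * x.1 k
  map_add' x y := by
    simp [mul_add, Finset.sum_add_distrib]
    ring
  map_smul' c x := by
    simp [Finset.mul_sum, mul_left_comm]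

theorem heightFunctional_eDiff (a b : Fin n) :
    heightFunctional n (eDiff a b) = (b : ℕ) - (a : ℕ) := by
  change -∑ k : Fin n, ((k : ℕ) : ℝ) * (eDiff a b).1 k = _
  simp [eDiff_apply, mul_sub]

/-- Both sides are linear and equal 1 on every simple root. -/
theorem height_eq (x : hyper n) : (typeA n hn).height x = heightFunctional n x := by
  have h : ∀ i, heightFunctional n ((typeA n hn).simple i) = 1 := by
    intro i
    rw [simple_eq, simpleVec, heightFunctional_eDiff]
    simp
  conv_rhs => rw [← (typeA n hn).simple.sum_repr x, map_sum]
  simp [h, BasedRootSystem.height]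

theorem height_eDiff (a b : Fin n) :
    (typeA n hn).height (eDiff a b) = (b : ℕ) - (a : ℕ) := by
  rw [height_eq, heightFunctional_eDiff]

/-- The definition only chooses some root of maximal height. Heights are `b - a`, and `b - a ≥ n -
1` leaves a single pair of indices. -/
theorem highestRoot_eq :
    (typeA n hn).highestRoot = eDiff ⟨0, by omega⟩ ⟨n - 1, by omega⟩ := by
  obtain ⟨h1, h2⟩ := (typeA n hn).exists_highest.choose_spec
  change (typeA n hn).highestRoot ∈ _ at h1
  change ∀ α ∈ _, _ ≤ (typeA n hn).height (typeA n hn).highestRoot at h2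
  obtain ⟨a, b, hab, h⟩ := h1
  have h3 := h2 (eDiff ⟨0, by omega⟩ ⟨n - 1, by omega⟩)
    ⟨_, _, by rw [Ne, Fin.mk.injEq]; omega, rfl⟩
  rw [h, height_eDiff, height_eDiff] at h3
  have h4 : ((n - 1 : ℕ) : ℝ) + (a : ℕ) ≤ (b : ℕ) + (0 : ℕ) := by linarith
  have h5 : (n - 1) + (a : ℕ) ≤ (b : ℕ) + 0 := by exact_mod_cast h4
  rw [h]
  congr 1 <;> apply Fin.ext <;> simp <;> omega

theorem coxeterNumber_eq : (typeA n hn).coxeterNumber = n := by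
  rw [BasedRootSystem.coxeterNumber, highestRoot_eq, height_eDiff]
  simp only [Nat.cast_zero, sub_zero, Nat.floor_natCast]
  omega

theorem eDiff_mem_roots_iff (a b : Fin n) : eDiff a b ∈ (typeA n hn).roots ↔ a ≠ b := by
  refine ⟨fun h hab => ?_, fun h => ⟨a, b, h, rfl⟩⟩
  rw [hab, eDiff_self] at h
  exact (typeA n hn).zero_notMem h

theorem eDiff_mem_positiveRoots_iff (a b : Fin n) :
    eDiff a b ∈ (typeA n hn).positiveRoots ↔ a < b := by
  constructor
  · rintro ⟨h1, h2⟩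
    rw [eDiff_mem_roots_iff] at h1
    have h3 : 0 ≤ (typeA n hn).height (eDiff a b) := Finset.sum_nonneg fun i _ => h2 i
    rw [height_eDiff, sub_nonneg] at h3
    have h4 : (a : ℕ) ≤ (b : ℕ) := by exact_mod_cast h3
    exact lt_of_le_of_ne h4 h1
  · intro h
    refine ⟨(eDiff_mem_roots_iff a b).2 h.ne, ?_⟩
    obtain ⟨d, hd⟩ := Nat.exists_eq_add_of_le (Fin.le_def.mp h.le)
    obtain ⟨c, hc⟩ := eDiff_eq_sum (n := n) a d (by omega)
    have hb : b = ⟨a + d, by omega⟩ := Fin.ext hd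
    rw [hb]
    intro i
    rw [show eDiff a (⟨a + d, by omega⟩ : Fin n) = ∑ k, (c k : ℝ) • (typeA n hn).simple k by
      simp only [simple_eq]
      exact hc]
    rw [Module.Basis.repr_sum_self]
    positivity

end TypeA

/-! ## Affine roots as pairs of integers -/

section AffineRoots

variable {n : ℕ} (hn : 2 ≤ n)

/-- The affine root whose value at `x` is `x i - x j`, where `x` is unrolled. -/
def affRoot (i j : ℤ) : hyper n × ℝ :=
  (eDiff (residue hn i) (residue hn j), (((j - 1) / n - (i - 1) / n : ℤ) : ℝ))

theorem affRoot_mem_affineRoots_iff (i j : ℤ) :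
    affRoot hn i j ∈ (typeA n hn).affineRoots ↔ residue hn i ≠ residue hn j :=
  ⟨fun h => (eDiff_mem_roots_iff _ _).1 h.1, fun h => ⟨(eDiff_mem_roots_iff _ _).2 h, _, rfl⟩⟩

theorem exists_affRoot {a : hyper n × ℝ} (ha : a ∈ (typeA n hn).affineRoots) :
    ∃ i j : ℤ, a = affRoot hn i j := by
  obtain ⟨_, r⟩ := a
  obtain ⟨⟨b, c, _, rfl⟩, k, rfl⟩ := ha
  refine ⟨(b : ℕ) + 1, (c : ℕ) + 1 + n * k, ?_⟩
  have := window_ediv b 0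
  rw [mul_zero, add_zero] at this
  rw [affRoot, residue_window, residue_window_zero, window_ediv, this, sub_zero]

theorem affineHeight_affRoot (i j : ℤ) :
    (typeA n hn).affineHeight (affRoot hn i j) = j - i := by
  rw [BasedRootSystem.affineHeight, coxeterNumber_eq, affRoot, height_eDiff]
  have h1 : (i : ℝ) = _ := congrArg (Int.cast : ℤ → ℝ) (residue_add_ediv hn i)
  have h2 : (j : ℝ) = _ := congrArg (Int.cast : ℤ → ℝ) (residue_add_ediv hn j)
  rw [h1, h2]
  push_cast
  ring

/-- Integers are ordered lexicographically by quotient and then residue modulo `n`. The quotients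
give the coefficient of `δ` and the residues the sign of the finite root, so this order reproduces
the definition of positivity. -/
theorem affRoot_mem_positiveAffineRoots_iff (i j : ℤ) :
    affRoot hn i j ∈ (typeA n hn).positiveAffineRoots ↔ residue hn i ≠ residue hn j ∧ i < j := by
  rw [BasedRootSystem.positiveAffineRoots, Set.mem_sep_iff, affRoot_mem_affineRoots_iff]
  refine and_congr_right fun hne => ?_
  simp only [affRoot, eDiff_neg, eDiff_mem_positiveRoots_iff]
  have h1 := residue_add_ediv hn i
  have h2 := residue_add_ediv hn j
  have h3 := (residue hn i).2
  have h4 := (residue hn j).2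
  have h5 : (residue hn i : ℕ) ≠ residue hn j := fun h => hne (Fin.ext h)
  rw [Fin.lt_def, Fin.lt_def]
  generalize (residue hn i : ℕ) = a at *
  generalize (residue hn j : ℕ) = b at *
  generalize (i - 1) / (n : ℤ) = q at *
  generalize (j - 1) / (n : ℤ) = r at *
  have e1 : ((0 : ℝ) ≤ ((r - q : ℤ) : ℝ)) ↔ q ≤ r := by
    rw [← sub_nonneg (a := r)]
    exact_mod_cast Iff.rfl
  have e2 : ((0 : ℝ) < ((r - q : ℤ) : ℝ)) ↔ q < r := by
    rw [← sub_pos (a := r)]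
    exact_mod_cast Iff.rfl
  rw [e1, e2, h1, h2]
  have hn0 : (0 : ℤ) < n := by omega
  rcases lt_trichotomy q r with h | h | h
  · have : (n : ℤ) * (q + 1) ≤ n * r := mul_le_mul_of_nonneg_left (by omega) hn0.le
    rw [mul_add] at this
    omega
  · subst h
    omega
  · have : (n : ℤ) * (r + 1) ≤ n * q := mul_le_mul_of_nonneg_left (by omega) hn0.le
    rw [mul_add] at this
    omega

variable {hn}

/-- Subtracting the intertwining relation at `0` from the one at `v` cancels the integer shifts and
leaves the linear part. -/
theorem linear_apply_residue {g : hyper n ≃ᵃ[ℝ] hyper n} {σ : Equiv.Perm ℤ}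
    (h : Intertwines hn g σ) (v : hyper n) (i : ℤ) :
    (g.linear v).1 (residue hn (σ i)) = v.1 (residue hn i) := by
  have h0 := h 0 i
  have hv := h v i
  have hl : g v = g.linear v + g 0 := by
    have := g.map_vadd 0 v
    simpa using this
  rw [hl] at hv
  simp only [unroll, Submodule.coe_add, PiLp.add_apply, Submodule.coe_zero,
    PiLp.zero_apply] at h0 hv
  linarith

theorem linear_eDiff_residue {g : hyper n ≃ᵃ[ℝ] hyper n} {σ : affineSymmetricGroup n}
    (h : Intertwines hn g σ) (i j : ℤ) :
    g.linear (eDiff (residue hn i) (residue hn j)) =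
      eDiff (residue hn ((σ : Equiv.Perm ℤ) i)) (residue hn ((σ : Equiv.Perm ℤ) j)) := by
  apply Subtype.ext
  ext k
  obtain ⟨m, rfl⟩ : ∃ m, k = residue hn ((σ : Equiv.Perm ℤ) m) :=
    ⟨(σ : Equiv.Perm ℤ).symm ((k : ℕ) + 1), by
      rw [Equiv.apply_symm_apply, residue_window_zero]⟩
  rw [linear_apply_residue h, eDiff_apply, eDiff_apply]
  simp only [residue_map_eq_iff]

/-- For `g = w t_μ` this says `μ = -g⁻¹ 0`. The point `g⁻¹ 0` is convenient because its unrolled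
values are those of the origin, rearranged. -/
theorem linear_symm_apply_zero (g : hyper n ≃ᵃ[ℝ] hyper n) :
    g.linear.symm (g 0) = -g.symm 0 := by
  rw [LinearEquiv.symm_apply_eq]
  have := g.map_vadd 0 (g.symm 0)
  rw [vadd_eq_add, add_zero, g.apply_symm_apply, vadd_eq_add] at this
  rw [map_neg]
  exact (neg_eq_of_add_eq_zero_right this.symm).symm

theorem affineRootAction_affRoot {g : hyper n ≃ᵃ[ℝ] hyper n} {σ : affineSymmetricGroup n}
    (h : Intertwines hn g σ) (i j : ℤ) :
    BasedRootSystem.affineRootAction g (affRoot hn i j) =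
      affRoot hn ((σ : Equiv.Perm ℤ) i) ((σ : Equiv.Perm ℤ) j) := by
  refine Prod.ext (linear_eDiff_residue h i j) ?_
  have e : ∀ i, (g.symm 0).1 (residue hn i) - (((i - 1) / n : ℤ) : ℝ) =
      -((((σ : Equiv.Perm ℤ) i - 1) / n : ℤ) : ℝ) := by
    intro i
    have := h (g.symm 0) i
    rw [g.apply_symm_apply] at this
    simp only [unroll, Submodule.coe_zero, PiLp.zero_apply] at this
    linarith
  have e1 := e i
  have e2 := e j
  simp only [BasedRootSystem.affineRootAction, affRoot, linear_symm_apply_zero, inner_neg_left,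
    inner_eDiff]
  push_cast
  linarith

/-- Equality would give `n ∣ p`, impossible for coprime `n ≥ 2`. Hence every pair `(i, i + p)` is a
genuine affine root. -/
theorem residue_ne_residue_add {p : ℕ} (hpn : p.Coprime n) (i : ℤ) :
    residue hn i ≠ residue hn (i + p) := by
  intro h
  obtain ⟨q, hq⟩ := (residue_eq_residue_iff hn _ _).1 h
  have h1 : (n : ℤ) ∣ p := ⟨q, by linarith⟩
  have h2 : n ∣ p := by exact_mod_cast h1
  have h3 := Nat.eq_one_of_dvd_coprimes hpn h2 dvd_rfl
  omega

theorem mem_stable_iff {p : ℕ} (hpn : p.Coprime n) (g : (typeA n hn).affineWeylGroup) :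
    g ∈ (typeA n hn).stable p ↔ weylEquiv hn g ∈ stablePerms n p := by
  have hg := intertwines_weylEquiv g
  constructor
  · intro h i
    have h1 := h (affRoot hn i (i + p))
      ((affRoot_mem_affineRoots_iff hn _ _).2 (residue_ne_residue_add hpn i)) (by
        rw [affineHeight_affRoot]
        push_cast
        ring)
    rw [affineRootAction_affRoot hg, affRoot_mem_positiveAffineRoots_iff] at h1
    exact h1.2
  · intro h a ha hap
    obtain ⟨i, j, rfl⟩ := exists_affRoot hn ha
    rw [affineHeight_affRoot] at hap
    have hj : j = i + p := by
      have : (j : ℝ) = ((i + p : ℤ) : ℝ) := by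
        push_cast
        linarith
      exact_mod_cast this
    rw [affRoot_mem_affineRoots_iff] at ha
    rw [affineRootAction_affRoot hg, affRoot_mem_positiveAffineRoots_iff, Ne, residue_map_eq_iff]
    refine ⟨ha, ?_⟩
    rw [hj]
    exact h i

end AffineRoots

/-! ## The Sommers region -/

section Sommers

variable {n p : ℕ} {hn : 2 ≤ n}

/-- With `p = a n + b`, passing from `i` to `i + p` moves the residue `c` to `c + b`, which involves
a root of height `b` and the bound `-a`, or wraps it to `c + b - n`, which involves a root of height
`n - b` and the bound `a + 1`. -/
theorem mem_sommersRegion_iff (hpn : p.Coprime n) (x : hyper n) :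
    x ∈ (typeA n hn).sommersRegion p ↔ ∀ i : ℤ, unroll hn x (i + p) < unroll hn x i := by
  have hn0 : 0 < n := by omega
  have hb : p % n < n := Nat.mod_lt _ hn0
  have hp : ((p : ℕ) : ℤ) = (p % n : ℕ) + n * (p / n : ℕ) := by
    exact_mod_cast (Nat.mod_add_div p n).symm
  have hb0 : p % n ≠ 0 := by
    intro h
    have := Nat.eq_one_of_dvd_coprimes hpn (Nat.dvd_of_mod_eq_zero h) dvd_rfl
    omega
  simp only [BasedRootSystem.sommersRegion, coxeterNumber_eq, Set.mem_ofPred_eq]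
  generalize p % n = b at *
  generalize p / n = a at *
  constructor
  · rintro ⟨h1, h2⟩ i
    obtain ⟨c, q, rfl⟩ := exists_window hn i
    by_cases hc : (c : ℕ) + b < n
    · have h := h1 (eDiff c ⟨c + b, hc⟩) ((eDiff_mem_roots_iff _ _).2 fun h => by
        have := congrArg Fin.val h
        simp at this
        omega) (by rw [height_eDiff]; push_cast; ring)
      rw [inner_eDiff] at h
      have e : ((c : ℕ) : ℤ) + 1 + n * q + p =
          (((⟨c + b, hc⟩ : Fin n) : ℕ) : ℤ) + 1 + n * (q + a) := by
        rw [hp]; push_cast; ring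
      rw [e, unroll_window, unroll_window]
      push_cast
      linarith
    · have hc' : (c : ℕ) + b - n < n := by omega
      have h := h2 (eDiff ⟨c + b - n, hc'⟩ c) ((eDiff_mem_roots_iff _ _).2 fun h => by
        have := congrArg Fin.val h
        simp at this
        omega) (by
          rw [height_eDiff]
          simp only
          rw [Nat.cast_sub (by omega)]
          push_cast
          ring)
      rw [inner_eDiff] at h
      have e : ((c : ℕ) : ℤ) + 1 + n * q + p =
          (((⟨c + b - n, hc'⟩ : Fin n) : ℕ) : ℤ) + 1 + n * (q + a + 1) := by
        simp only
        rw [hp, Nat.cast_sub (by omega)]; push_cast; ring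
      rw [e, unroll_window, unroll_window]
      push_cast
      linarith
  · intro h
    constructor
    · rintro _ ⟨c, d, hcd, rfl⟩ hh
      rw [height_eDiff] at hh
      have hd : ((d : ℕ) : ℤ) = (c : ℕ) + b := by
        have : ((d : ℕ) : ℝ) = (c : ℕ) + b := by linarith
        exact_mod_cast this
      have := h ((c : ℕ) + 1)
      rw [show ((c : ℕ) : ℤ) + 1 + p = (d : ℕ) + 1 + n * a by rw [hp, hd]; ring,
        unroll_window, unroll_window_zero] at this
      rw [inner_eDiff]
      push_cast at this
      linarith
    · rintro _ ⟨c, d, hcd, rfl⟩ hh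
      rw [height_eDiff] at hh
      have hd : ((d : ℕ) : ℤ) + b = (c : ℕ) + n := by
        have : ((d : ℕ) : ℝ) + b = (c : ℕ) + n := by linarith
        exact_mod_cast this
      have := h ((d : ℕ) + 1)
      rw [show ((d : ℕ) : ℤ) + 1 + p = (c : ℕ) + 1 + n * (a + 1) by rw [hp]; linarith,
        unroll_window, unroll_window_zero] at this
      rw [inner_eDiff]
      push_cast at this
      linarith

theorem mem_fundamentalAlcove_iff (x : hyper n) :
    x ∈ (typeA n hn).fundamentalAlcove ↔
      (∀ k : ℕ, k + 1 < n → unroll hn x (k + 1 + 1) < unroll hn x (k + 1)) ∧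
        unroll hn x 1 - unroll hn x n < 1 := by
  have e : ∀ k : ℕ, ∀ hk : k < n, unroll hn x (k + 1) = x.1 ⟨k, hk⟩ :=
    fun k hk => unroll_window_zero hn x ⟨k, hk⟩
  have e0 := e 0 (by omega)
  have e1 := e (n - 1) (by omega)
  rw [Nat.cast_zero, zero_add] at e0
  rw [Nat.cast_sub (by omega), Nat.cast_one, sub_add_cancel] at e1
  rw [e0, e1, BasedRootSystem.fundamentalAlcove, Set.mem_ofPred_eq, highestRoot_eq, inner_eDiff]
  refine and_congr_left fun _ => ⟨fun h k hk => ?_, fun h i => ?_⟩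
  · have := h ⟨k, by omega⟩
    rw [simple_eq, simpleVec, inner_eDiff] at this
    have e2 := e (k + 1) hk
    rw [Nat.cast_add, Nat.cast_one] at e2
    rw [e k (by omega), e2]
    exact sub_pos.mp this
  · have h1 := i.2
    have := h i (by omega)
    have e2 := e ((i : ℕ) + 1) (by omega)
    rw [Nat.cast_add, Nat.cast_one] at e2
    rw [e i (by omega), e2] at this
    rw [simple_eq, simpleVec, inner_eDiff]
    exact sub_pos.mpr this

theorem unroll_smul (c : ℝ) (x : hyper n) (k : ℕ) (hk : k < n) :
    unroll hn (c • x) (k + 1) = c * unroll hn x (k + 1) := by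
  rw [unroll_window_zero hn (c • x) ⟨k, hk⟩, unroll_window_zero hn x ⟨k, hk⟩]
  rfl

theorem mem_dilatedAlcove_iff (hp : 0 < p) (x : hyper n) :
    x ∈ (typeA n hn).dilatedAlcove p ↔
      (∀ k : ℕ, k + 1 < n → unroll hn x (k + 1 + 1) < unroll hn x (k + 1)) ∧
        unroll hn x 1 - unroll hn x n < p := by
  have hp' : (0 : ℝ) < p := by exact_mod_cast hp
  have key : x ∈ (typeA n hn).dilatedAlcove p ↔
      (p : ℝ)⁻¹ • x ∈ (typeA n hn).fundamentalAlcove := by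
    constructor
    · rintro ⟨y, hy, rfl⟩
      simpa only [smul_smul, inv_mul_cancel₀ hp'.ne', one_smul] using hy
    · intro h
      exact ⟨_, h, by simp only [smul_smul, mul_inv_cancel₀ hp'.ne', one_smul]⟩
  have e0 := unroll_smul (hn := hn) (p : ℝ)⁻¹ x 0 (by omega)
  have e1 := unroll_smul (hn := hn) (p : ℝ)⁻¹ x (n - 1) (by omega)
  rw [Nat.cast_zero, zero_add] at e0
  rw [Nat.cast_sub (by omega), Nat.cast_one, sub_add_cancel] at e1
  rw [key, mem_fundamentalAlcove_iff, e0, e1, ← mul_sub, inv_mul_lt_iff₀ hp', mul_one]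
  refine and_congr_left fun _ => forall₂_congr fun k hk => ?_
  have e2 := unroll_smul (hn := hn) (p : ℝ)⁻¹ x (k + 1) hk
  rw [Nat.cast_add, Nat.cast_one] at e2
  rw [unroll_smul _ x k (by omega), e2, mul_lt_mul_iff_right₀ (inv_pos.mpr hp')]

end Sommers

/-! ## The affine permutation with window `p + c, 2 p + c, …, n p + c` -/

section SlopePerm

variable {n p : ℕ} (hn : 2 ≤ n)

/-- The shift that balances the window `p, 2 p, …, n p`. -/
def slopeShift (n p : ℕ) : ℤ := (1 - p) * (n + 1) / 2

/-- Coprimality excludes that `p` and `n` are both even, so `1 - p` or `n + 1` is even and the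
integer division in `slopeShift` is exact. -/
theorem two_mul_slopeShift (hpn : p.Coprime n) : 2 * slopeShift n p = (1 - p) * (n + 1) := by
  refine Int.mul_ediv_cancel' ?_
  rcases Nat.even_or_odd p with h | h
  · have h1 : Odd n := by
      by_contra h2
      rw [Nat.not_odd_iff_even] at h2
      have := Nat.eq_one_of_dvd_coprimes hpn h.two_dvd h2.two_dvd
      omega
    obtain ⟨m, rfl⟩ := h1
    exact Dvd.dvd.mul_left ⟨(m : ℤ) + 1, by push_cast; ring⟩ _
  · obtain ⟨m, rfl⟩ := h
    exact Dvd.dvd.mul_right ⟨-(m : ℤ), by push_cast; ring⟩ _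

/-- The function underlying `slopePerm`. -/
def slopeFun (p : ℕ) (i : ℤ) : ℤ :=
  p * ((residue hn i : ℕ) + 1) + slopeShift n p + n * ((i - 1) / n)

theorem slopeFun_window (k : Fin n) (q : ℤ) :
    slopeFun hn p ((k : ℕ) + 1 + n * q) = p * ((k : ℕ) + 1) + slopeShift n p + n * q := by
  rw [slopeFun, residue_window, window_ediv]

/-- Multiplication by `p` is injective modulo `n`. -/
theorem slope_injective (hpn : p.Coprime n) (c : ℤ) :
    Function.Injective fun k : Fin n => residue hn (p * ((k : ℕ) + 1) + c) := by
  intro k l h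
  obtain ⟨q, hq⟩ := (residue_eq_residue_iff hn _ _).1 h
  have h1 : (n : ℤ) ∣ p * (((l : ℕ) : ℤ) - (k : ℕ)) := ⟨q, by linarith⟩
  have h2 := IsCoprime.dvd_of_dvd_mul_left (Nat.isCoprime_iff_coprime.mpr hpn.symm) h1
  have h3 := Int.eq_zero_of_abs_lt_dvd h2 (by
    have := k.2
    have := l.2
    rw [abs_lt]
    constructor <;> omega)
  exact Fin.ext (by omega)

theorem slopeFun_bijective (hpn : p.Coprime n) : Function.Bijective (slopeFun hn p) := by
  have hinj := slope_injective hn hpn (slopeShift n p)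
  have hn0 : (n : ℤ) ≠ 0 := by omega
  constructor
  · intro i j h
    obtain ⟨k, q, rfl⟩ := exists_window hn i
    obtain ⟨l, r, rfl⟩ := exists_window hn j
    rw [slopeFun_window, slopeFun_window] at h
    have hkl : k = l := by
      apply hinj
      have := congrArg (residue hn) h
      simpa only [residue_add_mul] using this
    subst hkl
    have : (n : ℤ) * q = n * r := by linarith
    rw [this]
  · intro j
    obtain ⟨k, hk⟩ := (Finite.injective_iff_surjective.mp hinj) (residue hn j)
    obtain ⟨q, hq⟩ := (residue_eq_residue_iff hn _ _).1 hk
    exact ⟨(k : ℕ) + 1 + n * q, by rw [slopeFun_window, hq]⟩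

theorem two_mul_sum_window (n : ℕ) : 2 * ∑ k : Fin n, (((k : ℕ) : ℤ) + 1) = n * (n + 1) := by
  have h := sum_fin_succ n
  rw [eq_div_iff two_ne_zero] at h
  rw [mul_comm]
  exact_mod_cast h

/-- The affine permutation with window `p + c, 2 p + c, …, n p + c`. -/
def slopePerm (hpn : p.Coprime n) : affineSymmetricGroup n :=
  ⟨Equiv.ofBijective _ (slopeFun_bijective hn hpn), by
    have hw := slopeFun_window (p := p) hn
    constructor
    · intro i
      obtain ⟨k, q, rfl⟩ := exists_window hn i
      rw [Equiv.ofBijective_apply, Equiv.ofBijective_apply, hw,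
        show ((k : ℕ) : ℤ) + 1 + n * q + n = (k : ℕ) + 1 + n * (q + 1) by ring, hw]
      ring
    · simp only [Equiv.ofBijective_apply]
      rw [← sum_window_id, sum_window_fin (slopeFun hn p), sum_window_fin (fun i => i)]
      have h0 : ∀ k : Fin n, slopeFun hn p ((k : ℕ) + 1) =
          p * ((k : ℕ) + 1) + slopeShift n p := fun k => by simpa using hw k 0
      simp only [h0]
      rw [Finset.sum_add_distrib, ← Finset.mul_sum]
      have h1 := two_mul_slopeShift hpn
      have h2 := two_mul_sum_window n
      have h3 : (n : ℤ) * (2 * slopeShift n p) = n * ((1 - p) * (n + 1)) := by rw [h1]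
      simp only [Finset.sum_const, Finset.card_univ, Fintype.card_fin, nsmul_eq_mul]
      generalize ∑ k : Fin n, (((k : ℕ) : ℤ) + 1) = S at *
      have h4 : (p : ℤ) * (2 * S) = p * (n * (n + 1)) := by rw [h2]
      linarith⟩

theorem slopePerm_window (hpn : p.Coprime n) (k : Fin n) (q : ℤ) :
    (slopePerm hn hpn : Equiv.Perm ℤ) ((k : ℕ) + 1 + n * q) =
      p * ((k : ℕ) + 1) + slopeShift n p + n * q :=
  slopeFun_window hn k q

theorem slopePerm_apply_succ (hpn : p.Coprime n) {k : ℕ} (hk : k < n) :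
    (slopePerm hn hpn : Equiv.Perm ℤ) (k + 1) = p * (k + 1) + slopeShift n p := by
  simpa using slopePerm_window hn hpn ⟨k, hk⟩ 0

end SlopePerm

/-! ## The Sommers element -/

section SommersElement

variable {n p : ℕ} {hn : 2 ≤ n}

/-- The coordinates `1, …, n` of `g x` are the values of `x` at `p + c, …, n p + c`, which meet
every residue class modulo `n`. The simple-root inequalities are therefore `x (i + p) < x i` in all
classes but one. -/
theorem mem_dilatedAlcove_iff_mem_sommersRegion (hp : 0 < p) (hpn : p.Coprime n)
    {g : hyper n ≃ᵃ[ℝ] hyper n}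
    (hg : Intertwines hn g ((slopePerm hn hpn)⁻¹ : affineSymmetricGroup n)) (x : hyper n) :
    g x ∈ (typeA n hn).dilatedAlcove p ↔ x ∈ (typeA n hn).sommersRegion p := by
  have e : ∀ k : ℕ, k < n →
      unroll hn (g x) (k + 1) = unroll hn x (p * (k + 1) + slopeShift n p) := by
    intro k hk
    have h := hg x ((slopePerm hn hpn : Equiv.Perm ℤ) (k + 1))
    rw [slopePerm_apply_succ hn hpn hk] at h
    rw [← h, ← slopePerm_apply_succ hn hpn hk]
    simp
  have e0 := e 0 (by omega)
  have e1 := e (n - 1) (by omega)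
  rw [Nat.cast_zero, zero_add, mul_one] at e0
  rw [Nat.cast_sub (by omega), Nat.cast_one, sub_add_cancel] at e1
  rw [mem_dilatedAlcove_iff hp, mem_sommersRegion_iff hpn, e0, e1]
  set c := slopeShift n p
  -- The step after the last sample returns to the first one shifted by `n p`. This turns the
  -- highest-root inequality with bound `p` into the missing instance of `x (i + p) < x i`.
  have e2 : unroll hn x (p * n + c + p) = unroll hn x (p + c) - p := by
    rw [show (p : ℤ) * n + c + p = p + c + n * p by ring, unroll_add_mul, Int.cast_natCast]
  constructor
  · rintro ⟨h1, h2⟩ i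
    obtain ⟨j, rfl⟩ := (slopePerm hn hpn : Equiv.Perm ℤ).surjective i
    obtain ⟨k, q, rfl⟩ := exists_window hn j
    rw [slopePerm_window, show (p : ℤ) * ((k : ℕ) + 1) + slopeShift n p + n * q + p =
      p * ((k : ℕ) + 1) + c + p + n * q by ring, unroll_add_mul, unroll_add_mul]
    refine sub_lt_sub_right ?_ _
    by_cases hk : (k : ℕ) + 1 < n
    · have h3 := h1 k hk
      have e3 := e ((k : ℕ) + 1) hk
      rw [Nat.cast_add, Nat.cast_one] at e3
      rw [e k k.2, e3] at h3
      convert h3 using 2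
      ring
    · have hk' : ((k : ℕ) : ℤ) + 1 = n := by
        have := k.2
        omega
      rw [hk', e2]
      linarith
  · intro h
    constructor
    · intro k hk
      have e3 := e (k + 1) hk
      rw [Nat.cast_add, Nat.cast_one] at e3
      rw [e k (by omega), e3]
      convert h (p * (k + 1) + c) using 2
      ring
    · have := h (p * n + c)
      rw [e2] at this
      linarith

/-- The quantities `σ (i + p) - p - σ i` sum to zero over a window (`sum_shift`), so being
nonnegative they all vanish. Then `σ` commutes with the shifts by `p` and `n`, hence by 1, so it is
a translation of `ℤ`, and the window sum makes it trivial. -/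
theorem eq_one_of_le_shift (hn : 2 ≤ n) (hpn : p.Coprime n) (σ : affineSymmetricGroup n)
    (h : ∀ i, (σ : Equiv.Perm ℤ) i + p ≤ (σ : Equiv.Perm ℤ) (i + p)) : σ = 1 := by
  obtain ⟨hper, hsum⟩ := σ.2
  apply Subtype.ext
  generalize (σ : Equiv.Perm ℤ) = s at *
  have hs := sum_shift (τ := Equiv.addRight (p : ℤ)) hper (by
    intro i
    simp only [Equiv.coe_addRight]
    ring)
  simp only [Equiv.coe_addRight] at hs
  rw [← sub_eq_zero, ← Finset.sum_sub_distrib, Finset.sum_eq_zero_iff_of_nonneg (by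
    intro i _
    have := h (i + 1)
    linarith)] at hs
  have hp : ∀ i, s (i + p) = s i + p := by
    intro i
    obtain ⟨k, q, rfl⟩ := exists_window hn i
    have h1 := hs k (Finset.mem_range.mpr k.2)
    rw [show ((k : ℕ) : ℤ) + 1 + n * q + p = (k : ℕ) + 1 + p + n * q by ring,
      periodic_mul hper, periodic_mul hper]
    linarith
  obtain ⟨a, b, hab⟩ := Nat.isCoprime_iff_coprime.mpr hpn
  have h1 : ∀ i, s (i + (1 : ℕ)) = s i + (1 : ℕ) := by
    intro i
    rw [show i + ((1 : ℕ) : ℤ) = i + p * a + n * b by push_cast; linarith, periodic_mul hper,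
      periodic_mul hp]
    push_cast
    linarith
  have h2 : ∀ i, s i = s 0 + i := by
    intro i
    have := periodic_mul h1 0 i
    simpa using this
  have h3 : s 0 = 0 := by
    rw [← sum_window_id, ← sub_eq_zero, ← Finset.sum_sub_distrib,
      Finset.sum_congr rfl (g := fun _ => s 0) (fun i _ => by rw [h2]; ring)] at hsum
    simp only [Finset.sum_const, Finset.card_range, nsmul_eq_mul] at hsum
    rcases mul_eq_zero.mp hsum with h | h
    · omega
    · exact h
  ext i
  rw [h2, h3, zero_add]
  rfl

theorem unroll_sub_smul_eDiff (x : hyper n) (t : ℝ) (a b : Fin n) (i : ℤ) :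
    unroll hn (x - t • eDiff a b) i = unroll hn x i -
      t * ((if residue hn i = a then 1 else 0) - (if residue hn i = b then 1 else 0)) := by
  simp only [unroll, Submodule.coe_sub, Submodule.coe_smul, PiLp.sub_apply, PiLp.smul_apply,
    eDiff_apply, smul_eq_mul]
  ring

/-- At the barycenter each defining inequality has slack `p / n`, and the perturbation changes each
difference by at most `2 t`. -/
theorem barycenter_sub_mem_sommersRegion (hpn : p.Coprime n) {t : ℝ} (ht : 0 ≤ t)
    (htp : 2 * t < p / n) (a b : Fin n) :
    barycenter n - t • eDiff a b ∈ (typeA n hn).sommersRegion p := by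
  rw [mem_sommersRegion_iff hpn]
  intro i
  rw [unroll_sub_smul_eDiff, unroll_sub_smul_eDiff, unroll_barycenter, unroll_barycenter]
  push_cast
  rw [add_div (i : ℝ)]
  have h1 : ∀ c d : Fin n, (if c = d then (1 : ℝ) else 0) ≤ 1 ∧
      0 ≤ (if c = d then (1 : ℝ) else 0) := by
    intro c d
    split_ifs <;> norm_num
  obtain ⟨_, h2⟩ := h1 (residue hn (i + p)) a
  obtain ⟨h3, _⟩ := h1 (residue hn (i + p)) b
  obtain ⟨h4, _⟩ := h1 (residue hn i) a
  obtain ⟨_, h5⟩ := h1 (residue hn i) b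
  generalize (if residue hn (i + p) = a then (1 : ℝ) else 0) = u1 at *
  generalize (if residue hn (i + p) = b then (1 : ℝ) else 0) = u2 at *
  generalize (if residue hn i = a then (1 : ℝ) else 0) = u3 at *
  generalize (if residue hn i = b then (1 : ℝ) else 0) = u4 at *
  have h6 : t * (u3 - u4 - (u1 - u2)) ≤ t * 2 := mul_le_mul_of_nonneg_left (by linarith) ht
  linarith

/-- Applied to points near the boundary of the region, preservation forces `σ⁻¹ (i + p) ≥ σ⁻¹ i +
p`, and `eq_one_of_le_shift` concludes. -/
theorem eq_one_of_preserves_sommersRegion (hpn : p.Coprime n) (hp : 0 < p)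
    {g : (typeA n hn).affineWeylGroup}
    (h : ∀ x ∈ (typeA n hn).sommersRegion p,
      (g : hyper n ≃ᵃ[ℝ] hyper n) x ∈ (typeA n hn).sommersRegion p) : g = 1 := by
  have hn0 : (0 : ℝ) < n := by positivity
  have hp1 : (1 : ℝ) ≤ p := by exact_mod_cast hp
  set σ := weylEquiv hn g with hσ
  have hg : Intertwines hn g σ := intertwines_weylEquiv g
  have key : ∀ x ∈ (typeA n hn).sommersRegion p, ∀ i,
      unroll hn x (((σ⁻¹ : affineSymmetricGroup n) : Equiv.Perm ℤ) (i + p)) <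
        unroll hn x (((σ⁻¹ : affineSymmetricGroup n) : Equiv.Perm ℤ) i) := by
    intro x hx i
    have h1 := (mem_sommersRegion_iff hpn _).1 (h x hx) i
    rw [← hg, ← hg x]
    simpa using h1
  have h1 : σ⁻¹ = 1 := by
    refine eq_one_of_le_shift hn hpn _ fun i => ?_
    have hne := (residue_map_eq_iff (hn := hn) σ⁻¹).not.mpr (residue_ne_residue_add hpn i)
    have hk := fun x hx => key x hx i
    generalize ((σ⁻¹ : affineSymmetricGroup n) : Equiv.Perm ℤ) i = j at *
    generalize ((σ⁻¹ : affineSymmetricGroup n) : Equiv.Perm ℤ) (i + p) = k at *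
    -- With `2 t = (p - 1/2) / n`, just below the allowed `p / n`, the inequality reads `j + p - 1/2
    -- < k`, that is `j + p ≤ k` for integers.
    have h2 := hk _ (barycenter_sub_mem_sommersRegion hpn (t := (p - 1 / 2) / (2 * n))
      (div_nonneg (by linarith) (by positivity))
      (by
        rw [← mul_div_assoc, mul_div_mul_left _ _ two_ne_zero]
        exact div_lt_div_of_pos_right (by linarith) hn0)
      (residue hn j) (residue hn k))
    rw [unroll_sub_smul_eDiff, unroll_sub_smul_eDiff, unroll_barycenter, unroll_barycenter,
      if_neg (Ne.symm hne), if_pos rfl, if_pos rfl, if_neg hne] at h2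
    have h3 : (j : ℝ) / n + 2 * ((p - 1 / 2) / (2 * n)) < k / n := by linarith
    rw [← mul_div_assoc, mul_div_mul_left _ _ two_ne_zero, ← add_div,
      div_lt_div_iff_of_pos_right hn0] at h3
    have h4 : ((j + p - 1 : ℤ) : ℝ) < k := by
      push_cast
      linarith
    have h5 : j + p - 1 < k := by exact_mod_cast h4
    omega
  have h2 : weylEquiv hn g = 1 := inv_eq_one.mp h1
  exact (MulEquiv.map_eq_one_iff _).mp h2

theorem isSommersElement_symm_slopePerm (hp : 0 < p) (hpn : p.Coprime n) :
    (typeA n hn).IsSommersElement p ((weylEquiv hn).symm (slopePerm hn hpn)⁻¹) := by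
  have hg := intertwines_weylEquiv ((weylEquiv hn).symm (slopePerm hn hpn)⁻¹)
  rw [MulEquiv.apply_symm_apply] at hg
  have key := mem_dilatedAlcove_iff_mem_sommersRegion hp hpn hg
  ext x
  constructor
  · rintro ⟨y, hy, rfl⟩
    exact (key y).2 hy
  · intro hx
    obtain ⟨y, rfl⟩ :=
      ((weylEquiv hn).symm (slopePerm hn hpn)⁻¹ : hyper n ≃ᵃ[ℝ] hyper n).surjective x
    exact ⟨y, (key y).1 hx, rfl⟩

theorem isSommersElement_unique (hp : 0 < p) (hpn : p.Coprime n)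
    {g g' : (typeA n hn).affineWeylGroup} (h : (typeA n hn).IsSommersElement p g)
    (h' : (typeA n hn).IsSommersElement p g') : g = g' := by
  -- The element `g'⁻¹ g` maps the Sommers region into itself.
  refine (inv_mul_eq_one.mp (eq_one_of_preserves_sommersRegion hpn hp fun x hx => ?_)).symm
  have h1 : (g : hyper n ≃ᵃ[ℝ] hyper n) x ∈ (typeA n hn).dilatedAlcove p :=
    h ▸ Set.mem_image_of_mem _ hx
  rw [← h'] at h1
  obtain ⟨y, hy, hyx⟩ := h1
  change (g' : hyper n ≃ᵃ[ℝ] hyper n).symm ((g : hyper n ≃ᵃ[ℝ] hyper n) x) ∈ _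
  rw [← hyx, AffineEquiv.symm_apply_apply]
  exact hy

theorem existsUnique_isSommersElement (hp : 0 < p) (hpn : p.Coprime n) :
    ∃! g, (typeA n hn).IsSommersElement p g :=
  ⟨_, isSommersElement_symm_slopePerm hp hpn,
    fun _ h => isSommersElement_unique hp hpn h (isSommersElement_symm_slopePerm hp hpn)⟩

theorem weylEquiv_sommersElement (hp : 0 < p) (hpn : p.Coprime n) :
    weylEquiv hn ((typeA n hn).sommersElement p) = (slopePerm hn hpn)⁻¹ := by
  have h := existsUnique_isSommersElement (hn := hn) hp hpn
  have h1 : (typeA n hn).IsSommersElement p ((typeA n hn).sommersElement p) := by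
    rw [BasedRootSystem.sommersElement, dif_pos h]
    exact h.choose_spec.1
  rw [isSommersElement_unique hp hpn h1 (isSommersElement_symm_slopePerm hp hpn),
    MulEquiv.apply_symm_apply]

end SommersElement

/-! ## The finite torus -/

section Torus

variable {n p : ℕ} {hn : 2 ≤ n}

theorem cyclicQuotient_mk_eq_iff (u v : Fin n → ZMod p) :
    (QuotientAddGroup.mk u : CyclicQuotient n p) = QuotientAddGroup.mk v ↔
      ∃ m : ℤ, ∀ k, v k = u k + m := by
  rw [QuotientAddGroup.eq, AddSubgroup.mem_zmultiples_iff]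
  refine exists_congr fun m => ⟨fun h k => ?_, fun h => funext fun k => ?_⟩
  · have := congrFun h k
    simp only [Pi.smul_apply, Pi.add_apply, Pi.neg_apply, zsmul_eq_mul, mul_one] at this
    rw [this]
    ring
  · simp only [Pi.smul_apply, Pi.add_apply, Pi.neg_apply, zsmul_eq_mul, mul_one, h k]
    ring

theorem piTorus_mk (x : (typeA n hn).corootLattice) :
    piTorus n p hn (QuotientAddGroup.mk x) = QuotientAddGroup.mk (modP n p hn x) := rfl

theorem modP_apply {x : (typeA n hn).corootLattice} {k : Fin n} {z : ℤ} (h : x.1.1 k = z) :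
    modP n p hn x k = z := by
  change ((⌊x.1.1 k⌋ : ℤ) : ZMod p) = z
  rw [h, Int.floor_intCast]

/-- If all coordinates are congruent to `m` modulo `p`, the zero coordinate sum gives `p ∣ n m`,
hence `p ∣ m`, and every coordinate is divisible by `p`. -/
theorem piTorus_injective (hpn : p.Coprime n) : Function.Injective (piTorus n p hn) := by
  rw [injective_iff_map_eq_zero]
  intro y
  induction y using QuotientAddGroup.induction_on with
  | H x =>
    intro h
    rw [piTorus_mk, eq_comm, show (0 : CyclicQuotient n p) = QuotientAddGroup.mk 0 from rfl,
      cyclicQuotient_mk_eq_iff] at h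
    obtain ⟨m, hm⟩ := h
    choose z hz using coord_int x.2
    have hzm : ∀ k, (p : ℤ) ∣ z k - m := by
      intro k
      rw [← ZMod.intCast_zmod_eq_zero_iff_dvd]
      have := hm k
      rw [modP_apply (hz k), Pi.zero_apply, zero_add] at this
      push_cast
      rw [this, sub_self]
    have hsum : ∑ k, z k = 0 := by
      have : ∑ k, x.1.1 k = 0 := x.1.2
      simp only [hz] at this
      exact_mod_cast this
    have hpm : (p : ℤ) ∣ m := by
      have h1 : (p : ℤ) ∣ ∑ k, (z k - m) := Finset.dvd_sum fun k _ => hzm k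
      rw [Finset.sum_sub_distrib, hsum] at h1
      simp only [Finset.sum_const, Finset.card_univ, Fintype.card_fin, nsmul_eq_mul, zero_sub,
        dvd_neg] at h1
      exact IsCoprime.dvd_of_dvd_mul_left (Nat.isCoprime_iff_coprime.mpr hpn) h1
    have hpz : ∀ k, ∃ y, z k = p * y := fun k => by
      have := dvd_add (hzm k) hpm
      rwa [sub_add_cancel] at this
    choose y hy using hpz
    rw [QuotientAddGroup.eq_zero_iff]
    -- For `p = 0` the quotients `y k` need not sum to zero, but then all `z k` vanish.
    rcases Nat.eq_zero_or_pos p with rfl | hp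
    · have : x = 0 := by
        apply Subtype.ext
        apply Subtype.ext
        ext k
        simp [hz, hy]
      rw [this]
      exact AddSubgroup.zero_mem _
    · have hysum : ∑ k, y k = 0 := by
        simp only [hy, ← Finset.mul_sum] at hsum
        rcases mul_eq_zero.mp hsum with h | h
        · omega
        · exact h
      refine ⟨⟨⟨WithLp.toLp 2 fun k => (y k : ℝ), ?_⟩, mem_corootLattice_of_int y fun _ => rfl⟩,
        ?_⟩
      · change ∑ k, (y k : ℝ) = 0
        exact_mod_cast hysum
      · apply Subtype.ext
        apply Subtype.ext
        ext k
        rw [hz, hy]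
        simp

theorem piTorus_surjective (hp : 0 < p) (hpn : p.Coprime n) :
    Function.Surjective (piTorus n p hn) := by
  have : NeZero p := ⟨hp.ne'⟩
  intro v
  induction v using QuotientAddGroup.induction_on with
  | H v =>
    obtain ⟨a, b, hab⟩ := Nat.isCoprime_iff_coprime.mpr hpn
    set s : ℤ := ∑ k, ((v k).val : ℤ) with hs
    have h0 : 0 < n := by omega
    -- With `a p + b n = 1`, subtracting `b s` everywhere and `p a s` at one coordinate removes
    -- exactly the sum `s` of the lifts. The first correction is a multiple of `(1, …, 1)`, the
    -- second is zero modulo `p`.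
    set z : Fin n → ℤ := fun k => (v k).val - b * s - (if k = ⟨0, h0⟩ then p * (a * s) else 0)
      with hz
    have hsum : ∑ k, z k = 0 := by
      simp only [hz, Finset.sum_sub_distrib, ← hs]
      simp only [Finset.sum_const, Finset.card_univ, Fintype.card_fin, nsmul_eq_mul,
        Finset.sum_ite_eq', Finset.mem_univ, if_true]
      linear_combination (-s) * hab
    have hsum' : ∑ k, (z k : ℝ) = 0 := by exact_mod_cast hsum
    refine ⟨QuotientAddGroup.mk ⟨⟨WithLp.toLp 2 fun k => (z k : ℝ), hsum'⟩,
      mem_corootLattice_of_int z fun _ => rfl⟩, ?_⟩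
    rw [piTorus_mk, cyclicQuotient_mk_eq_iff]
    refine ⟨b * s, fun k => ?_⟩
    rw [modP_apply (z := z k) rfl]
    simp only [hz]
    split_ifs <;> simp

end Torus

/-! ## Parking functions -/

section Parking

variable {n p : ℕ}

theorem parkingFunction_lt (hp : 0 < p) {f : Fin n → ℕ} (hf : f ∈ parkingFunctions n p)
    (i : Fin n) : f i < p := by
  have h1 := hf p hp le_rfl
  rw [mul_comm] at h1
  have h2 := Nat.le_of_mul_le_mul_left h1 hp
  have h3 : (Finset.univ.filter fun i => f i < p) = Finset.univ :=
    Finset.eq_univ_of_card _ (le_antisymm (Finset.card_le_univ _) (by simpa using h2))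
  simpa using (Finset.ext_iff.mp h3 i)

/-- If `g = f + m` modulo `p` with `0 < m < p`, then `{g < m}` is the complement of `{f < p - m}`.
The parking bounds for these two sets add up to an equality, so both are sharp, giving `p ∣ n m` and
the contradiction `p ∣ m`. -/
theorem piParking_injective (hp : 0 < p) (hpn : p.Coprime n) :
    Function.Injective (piParking n p) := by
  have : NeZero p := ⟨hp.ne'⟩
  rintro ⟨f, hf⟩ ⟨g, hg⟩ h
  obtain ⟨m', hm'⟩ := (cyclicQuotient_mk_eq_iff _ _).1 h
  simp only at hm'
  obtain ⟨m, hmp, hm⟩ : ∃ m : ℕ, m < p ∧ (m' : ZMod p) = m :=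
    ⟨(m' : ZMod p).val, ZMod.val_lt _, by simp⟩
  have hfp := parkingFunction_lt hp hf
  have hgp := parkingFunction_lt hp hg
  have hfg : ∀ i, g i = f i + m ∨ g i + p = f i + m := by
    intro i
    have h1 := hm' i
    rw [hm, ← Nat.cast_add, ZMod.natCast_eq_natCast_iff'] at h1
    rw [Nat.mod_eq_of_lt (hgp i)] at h1
    have := hfp i
    by_cases h2 : f i + m < p
    · left
      rwa [Nat.mod_eq_of_lt h2] at h1
    · right
      rw [Nat.mod_eq_sub_mod (by omega), Nat.mod_eq_of_lt (by omega)] at h1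
      omega
  rcases Nat.eq_zero_or_pos m with rfl | hm0
  · apply Subtype.ext
    funext i
    have h1 := hfg i
    have h2 := hfp i
    have h3 := hgp i
    simp only
    omega
  · exfalso
    have h1 := hg m hm0 hmp.le
    have h2 := hf (p - m) (by omega) (by omega)
    have h3 : (Finset.univ.filter fun i => g i < m).card +
        (Finset.univ.filter fun i => f i < p - m).card = n := by
      rw [Finset.filter_congr (q := fun i => ¬ f i < p - m) (fun i _ => by
        have h1 := hfg i
        have h2 := hfp i
        have h3 := hgp i
        omega), add_comm, Finset.card_filter_add_card_filter_not]
      simp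
    generalize (Finset.univ.filter fun i => g i < m).card = A at *
    generalize (Finset.univ.filter fun i => f i < p - m).card = B at *
    have h4 : n * m + n * (p - m) = p * A + p * B := by
      rw [← mul_add, ← mul_add, h3, Nat.add_sub_cancel' hmp.le, mul_comm]
    have h5 : p ∣ n * m := ⟨A, by omega⟩
    have h6 := Nat.le_of_dvd hm0 (hpn.dvd_of_dvd_mul_left h5)
    omega

/-- A cycle lemma: let `S l` be the excess of `p #{a < l}` over `n l`. Rotating the values so that a
minimum `m` of `S` becomes the origin turns each parking inequality into `S m ≤ S l` for a suitable
`l`. -/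
theorem piParking_surjective (hp : 0 < p) : Function.Surjective (piParking n p) := by
  have : NeZero p := ⟨hp.ne'⟩
  intro v
  induction v using QuotientAddGroup.induction_on with
  | H v =>
    set a : Fin n → ℕ := fun k => (v k).val with ha
    have hap : ∀ k, a k < p := fun k => ZMod.val_lt _
    set A : ℕ → ℕ := fun l => (Finset.univ.filter fun k => a k < l).card with hA
    set S : ℕ → ℤ := fun l => p * A l - n * l with hS
    obtain ⟨m, hm, hmin⟩ := Finset.exists_min_image (Finset.range p) S ⟨0, by simpa using hp⟩
    rw [Finset.mem_range] at hm
    have hAp : A p = n := by simp [hA, hap]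
    have hA0 : A 0 = 0 := by simp [hA]
    -- The minimum was taken over `l < p`; the value `l = p` is covered by `S p = S 0 = 0`.
    have hmin' : ∀ l ≤ p, S m ≤ S l := by
      intro l hl
      rcases hl.eq_or_lt with rfl | hl
      · have h1 := hmin 0 (by simpa using hp)
        simp only [hS, hA0, hAp] at h1 ⊢
        push_cast at h1
        linarith [mul_comm (l : ℤ) n]
      · exact hmin l (by simpa using hl)
    set f : Fin n → ℕ := fun k => if m ≤ a k then a k - m else a k + p - m with hf
    have hcount : ∀ l, 1 ≤ l → l ≤ p → n * l ≤ p * (Finset.univ.filter fun k => f k < l).card := by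
      intro l hl hlp
      rcases le_or_gt (m + l) p with h | h
      · have h1 : (Finset.univ.filter fun k => f k < l).card + A m = A (m + l) := by
          rw [hA, ← Finset.card_union_of_disjoint]
          · congr 1
            ext k
            have := hap k
            simp only [Finset.mem_union, Finset.mem_filter, Finset.mem_univ, true_and, hf]
            split_ifs <;> omega
          · rw [Finset.disjoint_filter]
            intro k _
            simp only [hf]
            split_ifs <;> omega
        generalize (Finset.univ.filter fun k => f k < l).card = C at *
        have h2 := hmin' (m + l) h
        simp only [hS, ← h1] at h2
        push_cast at h2
        zify
        linarith
      -- Here the interval of values wraps past `p`: it consists of the values at least `m` and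
      -- those below `m + l - p`.
      · have h1 : (Finset.univ.filter fun k => f k < l).card + A m = n + A (m + l - p) := by
          have e : (Finset.univ.filter fun k => f k < l).card =
              (Finset.univ.filter fun k => ¬ a k < m).card + A (m + l - p) := by
            rw [hA, ← Finset.card_union_of_disjoint]
            · congr 1
              ext k
              have := hap k
              simp only [Finset.mem_union, Finset.mem_filter, Finset.mem_univ, true_and, hf]
              split_ifs <;> omega
            · rw [Finset.disjoint_filter]
              intro k _
              omega
          rw [e, add_right_comm, add_comm _ (A m), hA, Finset.card_filter_add_card_filter_not]
          simp
        generalize (Finset.univ.filter fun k => f k < l).card = C at *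
        have h2 := hmin' (m + l - p) (by omega)
        simp only [hS] at h2
        rw [Nat.cast_sub h.le] at h2
        zify at h1 ⊢
        have h3 : (p : ℤ) * (C + A m) =
          p * (n + A (m + l - p)) := by rw [h1]
        push_cast at h2
        linarith [mul_comm (p : ℤ) n]
    refine ⟨⟨f, hcount⟩, (cyclicQuotient_mk_eq_iff _ _).2 ⟨m, fun k => ?_⟩⟩
    have hav : v k = (a k : ZMod p) := by simp [ha]
    rw [hav]
    simp only [hf]
    split_ifs with h
    · rw [Nat.cast_sub h]
      simp
    · rw [Nat.cast_sub (by omega)]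
      simp

end Parking

/-! ## Comparison of the two Anderson maps -/

section Comparison

variable {n p : ℕ} {hn : 2 ≤ n}

/-- The unrolled origin is constantly `-q` on the block `1 + n q, …, n + n q`. -/
theorem intertwines_zero_coord {g : hyper n ≃ᵃ[ℝ] hyper n} {σ : Equiv.Perm ℤ}
    (h : Intertwines hn g σ) {k j : Fin n} {q : ℤ}
    (hk : σ ((j : ℕ) + 1 + n * q) = (k : ℕ) + 1) : (g 0).1 k = (-q : ℤ) := by
  have := h 0 ((j : ℕ) + 1 + n * q)
  rw [hk, unroll_window_zero, unroll_window] at this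
  rw [this]
  simp

/-- The only property of the combinatorial map that the comparison uses: it locates `w⁻¹` of each
label through the parking function. -/
theorem apply_rightmostLabel (hpn : p.Coprime n) (w : stablePerms n p) (k : Fin n) :
    (w.1 : Equiv.Perm ℤ) (p * ((combinatorialAnderson hn hpn w).label.symm k : ℕ) -
      n * (combinatorialAnderson hn hpn w).toParking.1 k + minGap w.1) = (k : ℕ) + 1 := by
  set i := (combinatorialAnderson hn hpn w).label.symm k with hi
  have h1 := stepLabel_val hn w.2 i
  have h2 : stepLabel hn w.2 i = k := (combinatorialAnderson hn hpn w).label.apply_symm_apply k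
  rw [h2, rightmostLabel_eq] at h1
  change (w.1 : Equiv.Perm ℤ) (p * (i : ℕ) - n * rowLength n p w.1 i + minGap w.1) = _
  linarith

theorem piTorus_uniformAnderson (hp : 0 < p) (hpn : p.Coprime n) (g : (typeA n hn).stable p)
    (hg : weylEquiv hn g.1 ∈ stablePerms n p) :
    piTorus n p hn ((typeA n hn).uniformAnderson p g) =
      piParking n p (combinatorialAnderson hn hpn ⟨weylEquiv hn g.1, hg⟩).toParking := by
  set f := (combinatorialAnderson hn hpn ⟨weylEquiv hn g.1, hg⟩).toParking with hf
  set M := minGap (weylEquiv hn g.1 : Equiv.Perm ℤ) with hM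
  have hint := intertwines_weylEquiv (g.1 * ((typeA n hn).sommersElement p)⁻¹)
  rw [map_mul, map_inv, weylEquiv_sommersElement hp hpn, inv_inv] at hint
  obtain ⟨a, b, hab⟩ := Nat.isCoprime_iff_coprime.mpr hpn
  rw [BasedRootSystem.uniformAnderson, piTorus_mk, piParking, cyclicQuotient_mk_eq_iff]
  -- Since `a p + b n = 1`, `b` is the inverse of `n` modulo `p`, so this is `(M - c) / n`, the same
  -- for all `k`.
  refine ⟨b * (M - slopeShift n p), fun k => ?_⟩
  have hk := apply_rightmostLabel (hn := hn) hpn ⟨weylEquiv hn g.1, hg⟩ k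
  rw [← hf] at hk
  simp only [← hM] at hk
  set i := (combinatorialAnderson hn hpn ⟨weylEquiv hn g.1, hg⟩).label.symm k
  obtain ⟨l, hl⟩ := (slopePerm hn hpn : Equiv.Perm ℤ).surjective
    (p * (i : ℕ) - n * f.1 k + M)
  obtain ⟨j, q, rfl⟩ := exists_window hn l
  rw [← hl] at hk
  have hcoord := intertwines_zero_coord hint (k := k) (j := j) (q := q) hk
  rw [modP_apply hcoord]
  rw [slopePerm_window] at hl
  have h1 : ((f.1 k : ℤ) : ZMod p) = ((-q + b * (M - slopeShift n p) : ℤ) : ZMod p) := by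
    rw [ZMod.intCast_eq_intCast_iff_dvd_sub]
    -- The quotient by `p`: multiply `-q - f_k` by `a p + b n`, then replace `n (-q - f_k) + M - c`
    -- by its multiple of `p` from `hl`.
    refine ⟨a * (-q - f.1 k) + b * ((j : ℕ) + 1 - (i : ℕ)), ?_⟩
    linear_combination (q + (f.1 k : ℤ)) * hab - b * hl
  push_cast at h1 ⊢
  exact h1

theorem weylEquiv_reflection {α : hyper n} (hα : α ∈ (typeA n hn).roots) {a b : Fin n}
    (hab : a ≠ b) (h : α = eDiff a b) (k : ℤ) :
    weylEquiv hn ((typeA n hn).reflection hα k) = transposition hn hab k := by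
  subst h
  exact weylEquiv_eq (intertwines_affReflection hab k)

theorem residue_eq_iff_modEq (i : ℤ) (a : Fin n) :
    residue hn i = a ↔ i ≡ (a : ℕ) + 1 [ZMOD n] := by
  rw [← residue_window_zero hn a, residue_eq_residue_iff, Int.modEq_iff_dvd]
  simp only [residue_window_zero]
  constructor
  · rintro ⟨q, hq⟩
    exact ⟨q, by linarith⟩
  · rintro ⟨q, hq⟩
    exact ⟨q, by linarith⟩

/-- At level 1 the displacement of the indices congruent to 1 is `(n - 1) - n = -1`, so the
transposition exchanges neighbours `n q` and `n q + 1`. -/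
theorem weylEquiv_highest_reflection :
    ⇑(weylEquiv hn ((typeA n hn).reflection (typeA n hn).highestRoot_mem 1) : Equiv.Perm ℤ) =
      affineTransposition n 0 := by
  have hab : (⟨0, by omega⟩ : Fin n) ≠ ⟨n - 1, by omega⟩ := by
    rw [Ne, Fin.mk.injEq]
    omega
  rw [weylEquiv_reflection _ hab highestRoot_eq]
  funext i
  have e : ((n - 1 : ℕ) : ℤ) + 1 = n := by omega
  have e0 : i ≡ n [ZMOD n] ↔ i ≡ 0 [ZMOD n] := by
    rw [Int.modEq_iff_dvd, Int.modEq_iff_dvd, sub_eq_neg_add, dvd_add_self_right, zero_sub]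
  -- The two definitions test the residue classes in opposite orders, so the classes must be
  -- disjoint; this needs `n ≥ 2`.
  have e1 : ¬ (i ≡ 0 [ZMOD n] ∧ i ≡ 0 + 1 [ZMOD n]) := by
    rintro ⟨h1, h2⟩
    have h3 := (h1.symm.trans h2).dvd
    have := Int.le_of_dvd (by norm_num) h3
    omega
  rw [transposition_apply, transpositionFun, affineTransposition]
  simp only [residue_eq_iff_modEq, e, e0, Nat.cast_zero]
  split_ifs with h1 h2 h2
  · exact absurd ⟨h2, h1⟩ e1
  · omega
  · omega
  · rfl

theorem weylEquiv_simple_reflection (i : Fin (n - 1)) :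
    ⇑(weylEquiv hn ((typeA n hn).reflection ((typeA n hn).simple_mem i) 0) : Equiv.Perm ℤ) =
      affineTransposition n ((i : ℕ) + 1) := by
  have hab : (⟨i, by omega⟩ : Fin n) ≠ ⟨i + 1, by omega⟩ := by simp
  rw [weylEquiv_reflection _ hab (simple_eq i)]
  funext m
  rw [transposition_apply, transpositionFun, affineTransposition]
  simp [residue_eq_iff_modEq]

end Comparison

end Anderson

end

theorem mainTheorem3 (n p : ℕ) (hn : 2 ≤ n) (hp : 0 < p) (hpn : p.Coprime n) :
    -- the element of the affine Weyl group used in the uniform Anderson map exists uniquely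
    (∃! g, (typeA n hn).IsSommersElement p g) ∧
    -- both targets are identified with `(ℤ/p)^n / (1, …, 1)`
    Function.Bijective (piTorus n p hn) ∧
    Function.Bijective (piParking n p) ∧
    -- the identification of the affine Weyl group with the affine symmetric group
    ∃ φ : (typeA n hn).affineWeylGroup ≃* affineSymmetricGroup n,
      (⇑(φ ((typeA n hn).reflection (typeA n hn).highestRoot_mem 1) : Equiv.Perm ℤ) =
        affineTransposition n 0) ∧
      (∀ i : Fin (n - 1), ⇑(φ ((typeA n hn).reflection ((typeA n hn).simple_mem i) 0) :
        Equiv.Perm ℤ) = affineTransposition n ((i : ℕ) + 1)) ∧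
      ∃ hφ : ∀ g, g ∈ (typeA n hn).stable p ↔ φ g ∈ stablePerms n p,
        piTorus n p hn ∘ (typeA n hn).uniformAnderson p =
          piParking n p ∘ LabelledDyckPath.toParking ∘ combinatorialAnderson hn hpn ∘
            fun g : (typeA n hn).stable p => ⟨φ g.1, (hφ g.1).1 g.2⟩ := by
  refine ⟨existsUnique_isSommersElement hp hpn,
    ⟨piTorus_injective hpn, piTorus_surjective hp hpn⟩,
    ⟨piParking_injective hp hpn, piParking_surjective hp⟩,
    weylEquiv hn, weylEquiv_highest_reflection, weylEquiv_simple_reflection,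
    mem_stable_iff hpn, ?_⟩
  funext g
  exact piTorus_uniformAnderson hp hpn g _
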